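/- Let $M$ be a smooth manifold (boundary and corners allowed) and let $\mathfrak g$ be a filtered real Lie algebra: $\mathfrak g=F_1\supseteq F_2\supseteq\cdots$ are ideals with $\bigcap_k F_k=0$ and $[F_i,F_j]\subseteq F_{i+j}$. The enveloping algebra $\mathbb U(\mathfrak g)$ carries the filtration in which $F_k\mathbb U(\mathfrak g)$, $k\ge 1$, is spanned by the products $x_1\cdots x_r$ with $x_i\in F_{l_i}$ and $l_1+\cdots+l_r\ge k$; hats denote completions, and $V\hat\otimes W$ is the completion of $V\otimes W$ with respect to $F_kV\otimes W$. For one-forms $a_1,\dots,a_n$ on $M$, $n\ge 1$, let $\psi_n(a_1,\dots,a_n)\in C^1(M)$ be the smooth singular cochain whose value on a smooth path $\sigma:[0,1]\to M$ is $$\int_{1\ge t_1\ge\cdots\ge t_n\ge 0}\bar\sigma^*a_1(t_1)\cdots\bar\sigma^*a_n(t_n),\qquad \bar\sigma(t)=\sigma(1-t)$$ (Gugenheim's $A_\infty$ de Rham map; $\psi_1(a)(\sigma)=-\int_\sigma a$). Let $\alpha\in\mathfrak g\hat\otimes\Omega^1(M)$ be a connection. Its holonomy $\mathsf{hol}_\alpha\in\mathbb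 U(\mathfrak g)\hat\otimes C^1(M)$ is the sum $\sum_{n\ge1}(\mathrm{id}\otimes\psi)_n(\alpha^{\otimes n})$, where $(\mathrm{id}\otimes\psi)_n$ maps $(u_1\otimes a_1)\otimes\cdots\otimes(u_n\otimes a_n)$ to $u_1\cdots u_n\otimes\psi_n(a_1,\dots,a_n)$; evaluating on a path $\gamma$ gives $\mathsf{hol}_\alpha(\gamma)\in\hat{\mathbb U}(\mathfrak g)$. Let $\gamma:[0,1]\to M$ be a smooth path and $\bar\gamma(t)=\gamma(1-t)$. Write $\gamma^*\alpha=A(t)\,dt$ with $A\in\mathfrak g\hat\otimes C^\infty([0,1])$. Then: 1. There are $\xi^i\in\mathfrak g$ and smooth functions $a_i$ on $[0,1]$ such that $A=\sum_i\xi^i\otimes a_i$ and every $F_k$ contains all but finitely many of the $\xi^i$. 2. For every such expansion $$\mathsf{hol}_\alpha(\gamma)=\sum_{k\ge1}\ \sum_{i_1,\dots,i_k}(-1)^k\left(\int_{1\ge t_1\ge\cdots\ge t_k\ge0}a_{i_1}(1-t_1)\cdots a_{i_k}(1-t_k)\,dt_1\cdots dt_k\right)\xi^{i_1}\cdots\xi^{i_k},$$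 with unconditional convergence in $\hat{\mathbb U}(\mathfrak g)$. 3. One has $\bar\gamma^*\alpha=-A(1-t)\,dt$, and the parallel transport equation along $\bar\gamma$, $$\frac{d}{dt}H_t=-A(1-t)\cdot H_t,\qquad H_0=1,$$ has a unique solution $H$ in $\mathbb U(\mathfrak g)\hat\otimes C^\infty([0,1])$. For all $t\in[0,1]$, $H_t-1$ is the sum of the series in 2 with the integrals taken over $t\ge t_1\ge\cdots\ge t_k\ge0$; in particular $H_1=1+\mathsf{hol}_\alpha(\gamma)$. So $1+\mathsf{hol}_\alpha(\gamma)$ is the parallel transport of $\alpha$ along $\gamma$ with reversed orientation. 4. For the opposite sign of the connection all signs disappear: the equation $\frac{d}{dt}H_t=A(1-t)\cdot H_t$, $H_0=1$, has a unique solution in $\mathbb U(\mathfrak g)\hat\otimes C^\infty([0,1])$; for all $t$, $H_t-1$ is the series of 2 without the signs $(-1)^k$ and with integrals over $t\ge t_1\ge\cdots\ge t_k\ge0$; and $H_1=1+\mathsf{hol}_{-\alpha}(\gamma)$, so that $\mathsf{hol}_{-\alpha}(\gamma)$ is the series without signs. -/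

import Mathlib

open scoped Manifold ContDiff TensorProduct
open Set Filter

noncomputable section

namespace Holonomy

universe u v w x

/-! ## Filtered vector spaces and their completions -/

/-- A decreasing filtration of a real vector space by linear subspaces. -/
structure VFiltration (V : Type u) [AddCommGroup V] [Module ℝ V] where
  F : ℕ → Submodule ℝ V
  anti : ∀ ⦃j k : ℕ⦄, j ≤ k → F k ≤ F j

/-- The completion `lim V / F_k V`, as the space of compatible sequences. -/
def completionSubmodule {V : Type u} [AddCommGroup V] [Module ℝ V] (Φ : VFiltration V) :
    Submodule ℝ (∀ k, V ⧸ Φ.F k) where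
  carrier := {z | ∀ ⦃j k : ℕ⦄ (h : j ≤ k), Submodule.factor (Φ.anti h) (z k) = z j}
  add_mem' := by
    intro a b ha hb j k h
    simp [ha h, hb h]
  zero_mem' := by
    intro j k h
    simp
  smul_mem' := by
    intro c a ha j k h
    simp [ha h]

/-- The completion of a filtered vector space. -/
abbrev Completion {V : Type u} [AddCommGroup V] [Module ℝ V] (Φ : VFiltration V) : Type u :=
  completionSubmodule Φ

namespace Completion

variable {V : Type u} [AddCommGroup V] [Module ℝ V] {Φ : VFiltration V}
variable {W : Type v} [AddCommGroup W] [Module ℝ W] {Ψ : VFiltration W}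
variable {X : Type w} [AddCommGroup X] [Module ℝ X] {Ξ : VFiltration X}

/-- The inverse limit topology, every quotient `V / F_k V` being discrete.  The kernels of the
projections to these quotients form a basis of neighbourhoods of `0`. -/
instance : TopologicalSpace (Completion Φ) :=
  ⨅ k, TopologicalSpace.induced (fun z : Completion Φ => z.1 k) ⊥

/-- The canonical map of a filtered vector space to its completion. -/
def of (Φ : VFiltration V) (v : V) : Completion Φ :=
  ⟨fun k => (Φ.F k).mkQ v, fun _ _ _ => rfl⟩

/-- The map induced on completions by a map that respects congruence modulo `F_k`, for all `k`
(a linear filtered map for instance). -/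
def map (f : V → W) (hf : ∀ k v v', v - v' ∈ Φ.F k → f v - f v' ∈ Ψ.F k)
    (z : Completion Φ) : Completion Ψ :=
  ⟨fun k => Quotient.map' f (fun v v' h => by
      rw [Submodule.quotientRel_def] at h ⊢
      exact hf k v v' h) (z.1 k), by
    intro j k h
    have hz := z.2 h
    dsimp only
    obtain ⟨v, hv⟩ := Submodule.Quotient.mk_surjective _ (z.1 k)
    rw [← hv] at hz ⊢
    rw [← hz]
    rfl⟩

/-- The map induced on completions by a two-variable map that respects congruence modulo `F_k`,
for all `k`. -/
def map₂ (f : V → W → X)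
    (hf : ∀ k v v' w w', v - v' ∈ Φ.F k → w - w' ∈ Ψ.F k → f v w - f v' w' ∈ Ξ.F k)
    (z : Completion Φ) (y : Completion Ψ) : Completion Ξ :=
  ⟨fun k => Quotient.map₂ f (fun v v' h w w' h' => by
      have h : (Submodule.quotientRel (Φ.F k)) v v' := h
      have h' : (Submodule.quotientRel (Ψ.F k)) w w' := h'
      change (Submodule.quotientRel (Ξ.F k)) _ _
      rw [Submodule.quotientRel_def] at h h' ⊢
      exact hf k v v' w w' h h') (z.1 k) (y.1 k), by
    intro j k h
    have hz := z.2 h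
    have hy := y.2 h
    dsimp only
    obtain ⟨v, hv⟩ := Submodule.Quotient.mk_surjective _ (z.1 k)
    obtain ⟨w, hw⟩ := Submodule.Quotient.mk_surjective _ (y.1 k)
    rw [← hv] at hz ⊢
    rw [← hw] at hy ⊢
    rw [← hz, ← hy]
    rfl⟩

end Completion

/-- The filtration `F_k V ⊗ W` of `V ⊗ W`. -/
def VFiltration.tensor {V : Type u} [AddCommGroup V] [Module ℝ V] (Φ : VFiltration V)
    (W : Type v) [AddCommGroup W] [Module ℝ W] : VFiltration (V ⊗[ℝ] W) where
  F k := LinearMap.range (LinearMap.rTensor W (Φ.F k).subtype)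
  anti := by
    intro j k h
    rintro _ ⟨z, rfl⟩
    refine ⟨LinearMap.rTensor W (Submodule.inclusion (Φ.anti h)) z, ?_⟩
    rw [← LinearMap.comp_apply, ← LinearMap.rTensor_comp]
    rfl

section tensorFacts

variable {V : Type u} [AddCommGroup V] [Module ℝ V] {Φ : VFiltration V}
variable {W : Type v} [AddCommGroup W] [Module ℝ W]
variable {V' : Type w} [AddCommGroup V'] [Module ℝ V'] {Φ' : VFiltration V'}
variable {W' : Type x} [AddCommGroup W'] [Module ℝ W']

theorem tmul_mem {k : ℕ} {v : V} (hv : v ∈ Φ.F k) (y : W) : v ⊗ₜ[ℝ] y ∈ (Φ.tensor W).F k :=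
  ⟨(⟨v, hv⟩ : Φ.F k) ⊗ₜ[ℝ] y, rfl⟩

theorem tensor_le {k : ℕ} {S : Submodule ℝ (V ⊗[ℝ] W)}
    (h : ∀ v ∈ Φ.F k, ∀ y : W, v ⊗ₜ[ℝ] y ∈ S) : (Φ.tensor W).F k ≤ S := by
  rintro _ ⟨z, rfl⟩
  induction z with
  | zero => simp
  | tmul v y => exact h v.1 v.2 y
  | add a b ha hb => rw [map_add]; exact S.add_mem ha hb

theorem tensorMap_mem (f : V →ₗ[ℝ] V') (g : W →ₗ[ℝ] W')
    (hf : ∀ k, ∀ v ∈ Φ.F k, f v ∈ Φ'.F k) {k : ℕ} {z : V ⊗[ℝ] W} (hz : z ∈ (Φ.tensor W).F k) :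
    TensorProduct.map f g z ∈ (Φ'.tensor W').F k := by
  have : (Φ.tensor W).F k ≤ ((Φ'.tensor W').F k).comap (TensorProduct.map f g) :=
    tensor_le fun v hv y => by
      rw [Submodule.mem_comap, TensorProduct.map_tmul]
      exact tmul_mem (hf k v hv) _
  exact this hz

end tensorFacts

/-- The map `V ⊗̂ W → V' ⊗̂ W'` induced by a filtered linear map `V → V'` and a linear map
`W → W'`. -/
def completedTensorMap {V : Type u} [AddCommGroup V] [Module ℝ V] {Φ : VFiltration V}
    {W : Type v} [AddCommGroup W] [Module ℝ W]
    {V' : Type w} [AddCommGroup V'] [Module ℝ V'] {Φ' : VFiltration V'}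
    {W' : Type x} [AddCommGroup W'] [Module ℝ W']
    (f : V →ₗ[ℝ] V') (g : W →ₗ[ℝ] W') (hf : ∀ k, ∀ v ∈ Φ.F k, f v ∈ Φ'.F k) :
    Completion (Φ.tensor W) → Completion (Φ'.tensor W') :=
  Completion.map (TensorProduct.map f g) fun k v v' h => by
    rw [← map_sub]
    exact tensorMap_mem f g hf h

/-- The map `V ⊗̂ W → V̂` induced by a linear functional on `W`. -/
def completedContraction {V : Type u} [AddCommGroup V] [Module ℝ V] {Φ : VFiltration V}
    {W : Type v} [AddCommGroup W] [Module ℝ W] (l : W →ₗ[ℝ] ℝ) :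
    Completion (Φ.tensor W) → Completion Φ :=
  Completion.map (fun z => TensorProduct.rid ℝ V (LinearMap.lTensor V l z)) fun k v v' h => by
    rw [← map_sub, ← map_sub]
    have : (Φ.tensor W).F k ≤
        (Φ.F k).comap ((TensorProduct.rid ℝ V).toLinearMap ∘ₗ LinearMap.lTensor V l) :=
      tensor_le fun v hv y => by
        simpa using (Φ.F k).smul_mem _ hv
    exact this h

/-! ## Filtered Lie algebras and their enveloping algebras -/

/-- A filtration of a real Lie algebra by ideals `𝔤 = F_1 ⊇ F_2 ⊇ ⋯` with zero intersection and
`[F_i, F_j] ⊆ F_{i+j}`; the index is extended by `F_0 = 𝔤`. -/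
structure LieFiltration (𝔤 : Type u) [LieRing 𝔤] [LieAlgebra ℝ 𝔤] where
  F : ℕ → LieIdeal ℝ 𝔤
  zero_eq : F 0 = ⊤
  one_eq : F 1 = ⊤
  anti : Antitone F
  iInf_eq : ⨅ k, F k = ⊥
  lie_mem : ∀ i j : ℕ, ∀ a ∈ F i, ∀ b ∈ F j, ⁅a, b⁆ ∈ F (i + j)

section envelope

variable {𝔤 : Type u} [LieRing 𝔤] [LieAlgebra ℝ 𝔤]

/-- The underlying filtration of the vector space `𝔤`. -/
def LieFiltration.lin (F : LieFiltration 𝔤) : VFiltration 𝔤 where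
  F k := (F.F k).toSubmodule
  anti := fun _ _ h => F.anti h

variable (𝔤) in
/-- The universal enveloping algebra of the real Lie algebra `𝔤`. -/
abbrev Env : Type u := UniversalEnvelopingAlgebra ℝ 𝔤

variable (𝔤) in
/-- The inclusion of `𝔤` into its universal enveloping algebra. -/
def envι : 𝔤 →ₗ[ℝ] Env 𝔤 :=
  (UniversalEnvelopingAlgebra.mkAlgHom ℝ 𝔤).toLinearMap ∘ₗ TensorAlgebra.ι ℝ

/-- The product in the enveloping algebra of (the elements in) a list of pairs `(l, x)`. -/
def listProd (L : List (ℕ × 𝔤)) : Env 𝔤 := (L.map fun p => envι 𝔤 p.2).prod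

/-- The filtration of the enveloping algebra that is inherited from the tensor algebra: `F_k` is
spanned by the products `x_1 ⋯ x_r` with `x_i ∈ F_{l_i} 𝔤` and `l_1 + ⋯ + l_r ≥ k`.  For `k ≥ 1`
the empty product does not occur, and `F_1` is the augmentation ideal; `F_0` is everything. -/
def LieFiltration.env (F : LieFiltration 𝔤) : VFiltration (Env 𝔤) where
  F k := Submodule.span ℝ {y | ∃ L : List (ℕ × 𝔤), (∀ p ∈ L, p.2 ∈ F.F p.1) ∧
    k ≤ (L.map Prod.fst).sum ∧ y = listProd L}
  anti := by
    intro j k h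
    apply Submodule.span_mono
    rintro y ⟨L, h1, h2, h3⟩
    exact ⟨L, h1, h.trans h2, h3⟩

theorem envι_mem (F : LieFiltration 𝔤) (k : ℕ) (a : 𝔤) (ha : a ∈ F.F k) :
    envι 𝔤 a ∈ F.env.F k :=
  Submodule.subset_span ⟨[(k, a)], by simpa using ha, by simp, by simp [listProd]⟩

theorem env_mul_mem (F : LieFiltration 𝔤) {i j : ℕ} {a b : Env 𝔤} (ha : a ∈ F.env.F i)
    (hb : b ∈ F.env.F j) : a * b ∈ F.env.F (i + j) := by
  have : F.env.F i * F.env.F j ≤ F.env.F (i + j) := by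
    simp only [LieFiltration.env]
    rw [Submodule.span_mul_span]
    apply Submodule.span_mono
    rintro _ ⟨_, ⟨L, h1, h2, rfl⟩, _, ⟨L', h1', h2', rfl⟩, rfl⟩
    refine ⟨L ++ L', ?_, ?_, ?_⟩
    · intro p hp
      rcases List.mem_append.1 hp with h | h
      · exact h1 p h
      · exact h1' p h
    · rw [List.map_append, List.sum_append]
      omega
    · simp [listProd]
  exact this (Submodule.mul_mem_mul ha hb)

theorem env_one_mem (F : LieFiltration 𝔤) : (1 : Env 𝔤) ∈ F.env.F 0 :=
  Submodule.subset_span ⟨[], by simp, by simp, by simp [listProd]⟩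

theorem env_hom_mem_zero (F : LieFiltration 𝔤) (f : TensorAlgebra ℝ 𝔤 →ₐ[ℝ] Env 𝔤)
    (hf : ∀ y, f (TensorAlgebra.ι ℝ y) = envι 𝔤 y) (z : TensorAlgebra ℝ 𝔤) :
    f z ∈ F.env.F 0 := by
  induction z using TensorAlgebra.induction with
  | algebraMap r =>
    rw [AlgHom.commutes, Algebra.algebraMap_eq_smul_one]
    exact Submodule.smul_mem _ _ (env_one_mem F)
  | ι y =>
    rw [hf]
    refine envι_mem F 0 y ?_
    rw [F.zero_eq]
    trivial
  | mul y z hy hz =>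
    rw [map_mul]
    have h := env_mul_mem F hy hz
    rwa [Nat.add_zero] at h
  | add y z hy hz =>
    rw [map_add]
    exact Submodule.add_mem _ hy hz

theorem env_mem_zero (F : LieFiltration 𝔤) (a : Env 𝔤) : a ∈ F.env.F 0 := by
  obtain ⟨z, hz⟩ : ∃ z, UniversalEnvelopingAlgebra.mkAlgHom ℝ 𝔤 z = a :=
    Quotient.exists_rep a
  rw [← hz]
  exact env_hom_mem_zero F _ (fun _ => rfl) z

variable {A : Type v} [Ring A] [Algebra ℝ A]

theorem envTensor_mul_mem (F : LieFiltration 𝔤) {i j : ℕ} {a b : Env 𝔤 ⊗[ℝ] A}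
    (ha : a ∈ (F.env.tensor A).F i) (hb : b ∈ (F.env.tensor A).F j) :
    a * b ∈ (F.env.tensor A).F (i + j) := by
  have h1 : (F.env.tensor A).F i ≤
      ((F.env.tensor A).F (i + j)).comap (LinearMap.mulRight ℝ b) := by
    refine tensor_le fun v hv y => ?_
    have h2 : (F.env.tensor A).F j ≤
        ((F.env.tensor A).F (i + j)).comap (LinearMap.mulLeft ℝ (v ⊗ₜ[ℝ] y)) := by
      refine tensor_le fun v' hv' y' => ?_
      simp only [Submodule.mem_comap, LinearMap.mulLeft_apply,
        Algebra.TensorProduct.tmul_mul_tmul]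
      exact tmul_mem (env_mul_mem F hv hv') _
    exact h2 hb
  exact h1 ha

theorem envTensor_mem_zero (F : LieFiltration 𝔤) (a : Env 𝔤 ⊗[ℝ] A) :
    a ∈ (F.env.tensor A).F 0 := by
  induction a with
  | zero => exact Submodule.zero_mem _
  | tmul v y => exact tmul_mem (env_mem_zero F v) y
  | add a b ha hb => exact Submodule.add_mem _ ha hb

theorem envTensor_mul_sub_mem (F : LieFiltration 𝔤) {k : ℕ} {a a' b b' : Env 𝔤 ⊗[ℝ] A}
    (ha : a - a' ∈ (F.env.tensor A).F k) (hb : b - b' ∈ (F.env.tensor A).F k) :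
    a * b - a' * b' ∈ (F.env.tensor A).F k := by
  have h : a * b - a' * b' = (a - a') * b + a' * (b - b') := by noncomm_ring
  rw [h]
  refine Submodule.add_mem _ ?_ ?_
  · simpa using envTensor_mul_mem F ha (envTensor_mem_zero F b)
  · simpa using envTensor_mul_mem F (envTensor_mem_zero F a') hb

theorem envTensor_pow_sub_mem (F : LieFiltration 𝔤) {k : ℕ} {a a' : Env 𝔤 ⊗[ℝ] A}
    (ha : a - a' ∈ (F.env.tensor A).F k) (n : ℕ) :
    a ^ n - a' ^ n ∈ (F.env.tensor A).F k := by
  induction n with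
  | zero => simp
  | succ n ih => rw [pow_succ, pow_succ]; exact envTensor_mul_sub_mem F ih ha

theorem envTensor_pow_mem (F : LieFiltration 𝔤) {a : Env 𝔤 ⊗[ℝ] A}
    (ha : a ∈ (F.env.tensor A).F 1) (n : ℕ) : a ^ n ∈ (F.env.tensor A).F n := by
  induction n with
  | zero => exact envTensor_mem_zero F _
  | succ n ih => rw [pow_succ]; exact envTensor_mul_mem F ih ha

/-- The product of `U(𝔤) ⊗̂ A`, extending `(u ⊗ a)(v ⊗ b) = uv ⊗ ab`. -/
def completedMul (F : LieFiltration 𝔤) :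
    Completion (F.env.tensor A) → Completion (F.env.tensor A) → Completion (F.env.tensor A) :=
  Completion.map₂ (· * ·) fun _ _ _ _ _ h h' => envTensor_mul_sub_mem F h h'

end envelope

/-! ## Paths, one-forms, pullbacks -/

/-- The unit interval, a manifold with boundary (and the standard simplex of dimension one). -/
abbrev UI : Type := Set.Icc (0 : ℝ) 1

/-- The algebra of smooth functions on the unit interval. -/
abbrev SmoothFun : Type := C^∞⟮𝓡∂ 1, UI; 𝓘(ℝ), ℝ⟯

/-- Composition with the projection of the line to the unit interval: the extension of a
function on the interval that is constant to the left and to the right. -/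
def extend {X : Type*} (f : UI → X) : ℝ → X := fun t => f (Set.projIcc 0 1 zero_le_one t)

theorem extend_coe {X : Type*} (f : UI → X) (t : UI) : extend f (t : ℝ) = f t := by
  simp [extend]

theorem SmoothFun.contDiffOn (f : SmoothFun) : ContDiffOn ℝ ∞ (extend f) (Set.Icc 0 1) := by
  rw [← contMDiffOn_iff_contDiffOn]
  exact contMDiffOn_comp_projIcc_iff.2 f.contMDiff

theorem SmoothFun.continuous_extend (f : SmoothFun) : Continuous (extend f) :=
  f.contMDiff.continuous.comp continuous_projIcc

/-- A smooth function on the unit interval, from a function of a real variable that is smooth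
on the unit interval. -/
def SmoothFun.mk (g : ℝ → ℝ) (hg : ContDiffOn ℝ ∞ g (Set.Icc 0 1)) : SmoothFun :=
  ⟨fun t => g t, by
    have h := (contMDiffOn_iff_contDiffOn.2 hg).comp_contMDiff
      (contMDiff_subtypeVal_Icc (x := (0 : ℝ)) (y := 1) (n := ∞)) (fun t => t.2)
    exact h⟩

/-- Differentiation of smooth functions on the unit interval (one-sided at the endpoints). -/
def ddt : SmoothFun →ₗ[ℝ] SmoothFun where
  toFun f := SmoothFun.mk (derivWithin (extend f) (Set.Icc 0 1))
    (f.contDiffOn.derivWithin (uniqueDiffOn_Icc zero_lt_one) (by simp))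
  map_add' f g := by
    ext t
    have hf := (f.contDiffOn.differentiableOn (by simp)) t t.2
    have hg := (g.contDiffOn.differentiableOn (by simp)) t t.2
    exact derivWithin_add hf hg
  map_smul' c f := by
    ext t
    have hf := (f.contDiffOn.differentiableOn (by simp)) t t.2
    exact derivWithin_const_smul c hf

/-- Evaluation of smooth functions at a point of the unit interval. -/
def evalAt (t : UI) : SmoothFun →ₗ[ℝ] ℝ where
  toFun f := f t
  map_add' _ _ := rfl
  map_smul' _ _ := rfl

/-- The reversal `t ↦ 1 - t` of the unit interval. -/
def reversal : C^∞⟮𝓡∂ 1, UI; 𝓡∂ 1, UI⟯ :=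
  ⟨unitInterval.symm, by
    rw [contMDiff_iff_comp_subtypeVal_Icc]
    refine ⟨unitInterval.continuous_symm, ?_⟩
    have h : ContMDiff 𝓘(ℝ) 𝓘(ℝ) ∞ (fun t : ℝ => 1 - t) :=
      (contDiff_const.sub contDiff_id).contMDiff
    exact h.comp contMDiff_subtypeVal_Icc⟩

/-- The map `f ↦ (t ↦ f(1 - t))` on smooth functions. -/
def reverseFun : SmoothFun →ₗ[ℝ] SmoothFun where
  toFun f := f.comp reversal
  map_add' _ _ := rfl
  map_smul' _ _ := rfl

section manifold

variable {E : Type u} [NormedAddCommGroup E] [NormedSpace ℝ E]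
variable {H : Type v} [TopologicalSpace H] (I : ModelWithCorners ℝ E H)
variable (M : Type w) [TopologicalSpace M] [ChartedSpace H M]

/-- Smooth paths in `M`, which are the smooth singular simplices of dimension one. -/
abbrev SmoothPath : Type w := C^∞⟮𝓡∂ 1, UI; I, M⟯

/-- Smooth singular one-cochains with real coefficients. -/
abbrev Cochain1 : Type w := SmoothPath I M → ℝ

variable [IsManifold I ∞ M]

/-- Smooth one-forms: smooth sections of the cotangent bundle. -/
abbrev OneForm : Type (max u w) :=
  Cₛ^∞⟮I; E →L[ℝ] ℝ, fun p : M => (TangentSpace I p →L[ℝ] ℝ)⟯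


variable {I M}

theorem pullback_contMDiff (γ : SmoothPath I M) (a : OneForm I M) :
    ContMDiff (𝓡∂ 1) 𝓘(ℝ) ∞
      (fun t : UI => a (γ t) (mfderiv (𝓡∂ 1) I γ t (1 : TangentSpace (𝓡∂ 1) t))) := by
  have hg : ContMDiffOn 𝓘(ℝ) I ∞ (γ ∘ Set.projIcc (0 : ℝ) 1 zero_le_one) (Set.Icc 0 1) :=
    contMDiffOn_comp_projIcc_iff.2 γ.contMDiff
  have hu : UniqueMDiffOn 𝓘(ℝ) (Set.Icc (0 : ℝ) 1) :=
    (uniqueDiffOn_Icc zero_lt_one).uniqueMDiffOn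
  have h1 := hg.contMDiffOn_tangentMapWithin (m := ∞) (by simp) hu
  have h2 : ContMDiff 𝓘(ℝ) (𝓘(ℝ).prod 𝓘(ℝ)) ∞
      (fun t : ℝ => (⟨t, (1 : ℝ)⟩ : TangentBundle 𝓘(ℝ) ℝ)) :=
    contMDiff_vectorSpace_iff_contDiff.2 contDiff_const
  have h3 := h1.comp h2.contMDiffOn (s := Set.Icc (0 : ℝ) 1) (fun t ht => ht)
  have h4 : ContMDiffOn 𝓘(ℝ) (I.prod 𝓘(ℝ, E →L[ℝ] ℝ)) ∞
      (fun t : ℝ => Bundle.TotalSpace.mk' (E →L[ℝ] ℝ)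
        (E := fun p : M => (TangentSpace I p →L[ℝ] ℝ))
        ((γ ∘ Set.projIcc (0 : ℝ) 1 zero_le_one) t)
        (a ((γ ∘ Set.projIcc (0 : ℝ) 1 zero_le_one) t))) (Set.Icc 0 1) :=
    a.contMDiff.comp_contMDiffOn hg
  have h5 := ContMDiffOn.clm_bundle_apply (F₁ := E) (F₂ := ℝ) (E₂ := Bundle.Trivial M ℝ) h4 h3
  have h6 : ContMDiffOn 𝓘(ℝ) 𝓘(ℝ) ∞ (fun t : ℝ =>
      a ((γ ∘ Set.projIcc (0 : ℝ) 1 zero_le_one) t)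
        (mfderivWithin 𝓘(ℝ) I (γ ∘ Set.projIcc (0 : ℝ) 1 zero_le_one) (Set.Icc 0 1) t (1 : ℝ)))
      (Set.Icc 0 1) := by
    intro t ht
    have h7 := h5 t ht
    rw [Bundle.contMDiffWithinAt_totalSpace] at h7
    exact h7.2
  have h8 := h6.comp_contMDiff
      (contMDiff_subtypeVal_Icc (x := (0 : ℝ)) (y := 1) (n := ∞)) (fun t => t.2)
  refine h8.congr fun t => ?_
  have h9 := mfderivWithin_comp_projIcc_one (I := I) (f := γ) (w := t)
  have h10 : Set.projIcc (0 : ℝ) 1 zero_le_one (t : ℝ) = t := by simp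
  change _ = a (γ (Set.projIcc (0 : ℝ) 1 zero_le_one (t : ℝ))) _
  rw [h10]
  exact congrArg (a (γ t)) h9.symm

/-- The pullback of a one-form along a smooth path: the one-form `a(t) dt` on the unit interval,
identified with its coefficient function `a(t)`, the value of the form on the velocity vector. -/
def pullback (γ : SmoothPath I M) : OneForm I M →ₗ[ℝ] SmoothFun where
  toFun a := ⟨fun t => a (γ t) (mfderiv (𝓡∂ 1) I γ t (1 : TangentSpace (𝓡∂ 1) t)),
    pullback_contMDiff γ a⟩
  map_add' _ _ := rfl
  map_smul' _ _ := rfl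

end manifold

/-! ## Iterated integrals and the de Rham map -/

/-- The linear map on the tensor algebra that is given by multilinear maps `φ_n`, `n ≥ 1`, on
words of length `n`, and by zero on the empty word. -/
def barLift {V : Type u} [AddCommGroup V] [Module ℝ V] {N : Type v} [AddCommGroup N] [Module ℝ N]
    (φ : ∀ n, MultilinearMap ℝ (fun _ : Fin n => V) N) : TensorAlgebra ℝ V →ₗ[ℝ] N :=
  (DirectSum.toModule ℝ ℕ N fun n => if n = 0 then 0 else PiTensorProduct.lift (φ n)) ∘ₗ
  (TensorAlgebra.toDirectSum (R := ℝ) (M := V)).toLinearMap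

theorem barLift_tprod {V : Type u} [AddCommGroup V] [Module ℝ V]
    {N : Type v} [AddCommGroup N] [Module ℝ N]
    (φ : ∀ n, MultilinearMap ℝ (fun _ : Fin n => V) N) {n : ℕ} (hn : n ≠ 0) (a : Fin n → V) :
    barLift φ (TensorAlgebra.tprod ℝ V n a) = φ n a := by
  have h := TensorAlgebra.toDirectSum_tensorPower_tprod (R := ℝ) a
  unfold barLift
  rw [LinearMap.comp_apply, AlgHom.toLinearMap_apply, h]
  refine (DirectSum.toModule_lof ℝ n _).trans ?_
  rw [if_neg hn]
  exact PiTensorProduct.lift.tprod _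

/-- The simplex `s ≥ t_1 ≥ ⋯ ≥ t_n ≥ 0`. -/
def simplex (n : ℕ) (s : ℝ) : Set (Fin n → ℝ) :=
  {t | Antitone t ∧ ∀ i, 0 ≤ t i ∧ t i ≤ s}

/-- The multilinear map `(f_1, …, f_n) ↦ f_1(t_1) ⋯ f_n(t_n)`. -/
def evalProd {n : ℕ} (t : Fin n → ℝ) : MultilinearMap ℝ (fun _ : Fin n => SmoothFun) ℝ :=
  (MultilinearMap.mkPiAlgebra ℝ (Fin n) ℝ).compLinearMap
    fun i => evalAt (Set.projIcc 0 1 zero_le_one (t i))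

theorem evalProd_apply {n : ℕ} (t : Fin n → ℝ) (f : Fin n → SmoothFun) :
    evalProd t f = ∏ i, extend (f i) (t i) := rfl

theorem isCompact_simplex (n : ℕ) (s : ℝ) : IsCompact (simplex n s) := by
  have h : simplex n s = {t | Antitone t} ∩ Set.Icc (fun _ => 0) (fun _ => s) := by
    ext t
    simp only [simplex, Set.mem_ofPred_eq, Set.mem_inter_iff, Set.mem_Icc, Pi.le_def, forall_and]
  rw [h]
  refine isCompact_Icc.inter_left ?_
  have h' : {t : Fin n → ℝ | Antitone t} = ⋂ i, ⋂ j, ⋂ (_ : i ≤ j), {t | t j ≤ t i} := by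
    ext t
    simp [Antitone]
  rw [h']
  exact isClosed_iInter fun i => isClosed_iInter fun j => isClosed_iInter fun _ =>
    isClosed_le (continuous_apply j) (continuous_apply i)

theorem integrable_evalProd {n : ℕ} (s : ℝ) (f : Fin n → SmoothFun) :
    MeasureTheory.IntegrableOn (fun t => evalProd t f) (simplex n s) := by
  refine ContinuousOn.integrableOn_compact (isCompact_simplex n s) (Continuous.continuousOn ?_)
  simp only [evalProd_apply]
  exact continuous_finsetProd _ fun i _ => (f i).continuous_extend.comp (continuous_apply i)

/-- The iterated integral `∫_{s ≥ t_1 ≥ ⋯ ≥ t_n ≥ 0} f_1(t_1) ⋯ f_n(t_n) dt_1 ⋯ dt_n`, for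
`0 ≤ s ≤ 1`. -/
def iteratedIntegral (n : ℕ) (s : ℝ) : MultilinearMap ℝ (fun _ : Fin n => SmoothFun) ℝ where
  toFun f := ∫ t in simplex n s, ∏ i, extend (f i) (t i)
  map_update_add' := by
    intro _ f i a b
    simp only [← evalProd_apply, MultilinearMap.map_update_add]
    exact MeasureTheory.integral_add (integrable_evalProd s _) (integrable_evalProd s _)
  map_update_smul' := by
    intro _ f i c a
    simp only [← evalProd_apply, MultilinearMap.map_update_smul]
    exact MeasureTheory.integral_smul c _

section manifold

variable {E : Type u} [NormedAddCommGroup E] [NormedSpace ℝ E]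
variable {H : Type v} [TopologicalSpace H] (I : ModelWithCorners ℝ E H)
variable (M : Type w) [TopologicalSpace M] [ChartedSpace H M] [IsManifold I ∞ M]

variable {I M} in
/-- Chen's map on words of one-forms, evaluated at a path `c`: the integral over
`1 ≥ t_1 ≥ ⋯ ≥ t_n ≥ 0` of the pullback of `a_1 × ⋯ × a_n` along `t ↦ (c(t_1), …, c(t_n))`. -/
def chen (n : ℕ) (c : SmoothPath I M) : MultilinearMap ℝ (fun _ : Fin n => OneForm I M) ℝ :=
  (iteratedIntegral n 1).compLinearMap fun _ => pullback c

/-- The component `ψ_n` of Gugenheim's `A_∞` de Rham map on one-forms, with values in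
one-cochains: Chen's map, evaluated at the composition of the one-simplex with Igusa's path
`t ↦ 1 - t` in the interval, which runs through the interval backwards.  On one-forms all the
Koszul signs in Chen's map are trivial, and `ψ_1(a)(σ) = - ∫_σ a`. -/
def psi (n : ℕ) : MultilinearMap ℝ (fun _ : Fin n => OneForm I M) (Cochain1 I M) :=
  MultilinearMap.pi fun σ : SmoothPath I M => chen n (σ.comp reversal)

/-- The collection of the maps `ψ_n`, `n ≥ 1`, as one linear map on the tensor algebra (the bar
construction) of the space of one-forms. -/
def psiBar : TensorAlgebra ℝ (OneForm I M) →ₗ[ℝ] Cochain1 I M :=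
  barLift (psi I M)

variable {I M}

/-- Evaluation of cochains at a simplex. -/
def evalSimplex (γ : SmoothPath I M) : Cochain1 I M →ₗ[ℝ] ℝ := LinearMap.proj γ

/-! ## Connections and holonomy -/

variable {𝔤 : Type x} [LieRing 𝔤] [LieAlgebra ℝ 𝔤] (F : LieFiltration 𝔤)

variable (I M) in
/-- Connections with values in `𝔤`: the completed tensor product `𝔤 ⊗̂ Ω¹(M)`. -/
abbrev Connection : Type (max x u w) := Completion (F.lin.tensor (OneForm I M))

variable {F}

/-- The element of `U(𝔤) ⊗̂ W` given by an element of `𝔤 ⊗̂ W`. -/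
def toEnv {W : Type v} [AddCommGroup W] [Module ℝ W] :
    Completion (F.lin.tensor W) → Completion (F.env.tensor W) :=
  completedTensorMap (envι 𝔤) LinearMap.id (envι_mem F)

/-- The component `(id ⊗ ψ)_n (β^{⊗ n})` of the push-forward of `β ∈ U(𝔤) ⊗̂ Ω¹(M)` along the
`A_∞`-morphism `id ⊗ ψ`, given by
`(u_1 ⊗ a_1) ⊗ ⋯ ⊗ (u_n ⊗ a_n) ↦ u_1 ⋯ u_n ⊗ ψ_n(a_1 ⊗ ⋯ ⊗ a_n)`.
Here `β^{⊗ n}` is computed in the algebra `U(𝔤) ⊗ T(Ω¹(M))`. -/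
def pushTerm (n : ℕ) :
    Completion (F.env.tensor (OneForm I M)) → Completion (F.env.tensor (Cochain1 I M)) :=
  Completion.map
    (fun z => LinearMap.lTensor (Env 𝔤) (psiBar I M)
      ((LinearMap.lTensor (Env 𝔤) (TensorAlgebra.ι ℝ) z) ^ n))
    fun k z z' h => by
      have h1 : LinearMap.lTensor (Env 𝔤) (TensorAlgebra.ι ℝ) z -
          LinearMap.lTensor (Env 𝔤) (TensorAlgebra.ι ℝ) z' ∈
          (F.env.tensor (TensorAlgebra ℝ (OneForm I M))).F k := by
        rw [← map_sub]
        exact tensorMap_mem LinearMap.id _ (fun _ _ h => h) h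
      rw [← map_sub]
      exact tensorMap_mem LinearMap.id _ (fun _ _ h => h) (envTensor_pow_sub_mem F h1 n)

theorem pushTerm_eq_zero (α : Connection I M F) {j n : ℕ} (h : j ≤ n) :
    (pushTerm n (toEnv α)).1 j = 0 := by
  obtain ⟨z, hz⟩ := Submodule.Quotient.mk_surjective _ (α.1 j)
  have h0 : (pushTerm n (toEnv α)).1 j = Submodule.Quotient.mk
      (LinearMap.lTensor (Env 𝔤) (psiBar I M) ((LinearMap.lTensor (Env 𝔤) (TensorAlgebra.ι ℝ)
        (TensorProduct.map (envι 𝔤) LinearMap.id z)) ^ n)) := by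
    simp only [pushTerm, toEnv, completedTensorMap, Completion.map]
    rw [← hz]
    rfl
  rw [h0, Submodule.Quotient.mk_eq_zero]
  refine (F.env.tensor (Cochain1 I M)).anti h ?_
  refine tensorMap_mem LinearMap.id _ (fun _ _ h => h) (envTensor_pow_mem F ?_ n)
  refine tensorMap_mem LinearMap.id _ (fun _ _ h => h) ?_
  refine tensorMap_mem (Φ := F.lin) (envι 𝔤) LinearMap.id (envι_mem F) ?_
  clear h0 hz
  induction z with
  | zero => exact Submodule.zero_mem _
  | tmul v y =>
    refine tmul_mem ?_ y
    change v ∈ F.F 1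
    rw [F.one_eq]
    trivial
  | add a b ha hb => exact Submodule.add_mem _ ha hb

/-- The holonomy `hol_α ∈ U(𝔤) ⊗̂ C¹(M)`: the image of `α` under `𝔤 ⊗̂ Ω¹(M) → U(𝔤) ⊗̂ Ω¹(M)`,
followed by the push-forward `β ↦ ∑_{n ≥ 1} (id ⊗ ψ)_n (β^{⊗ n})`.  Modulo `F_k` all the terms
with `n ≥ k` vanish. -/
def hol (α : Connection I M F) : Completion (F.env.tensor (Cochain1 I M)) :=
  ⟨fun k => ∑ n ∈ Finset.Icc 1 k, (pushTerm n (toEnv α)).1 k, by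
    intro j k h
    dsimp only
    rw [map_sum]
    rw [Finset.sum_congr rfl fun n _ => (pushTerm n (toEnv α)).2 h]
    symm
    refine Finset.sum_subset (Finset.Icc_subset_Icc_right h) fun n _ hn => ?_
    refine pushTerm_eq_zero α ?_
    simp only [Finset.mem_Icc] at *
    omega⟩

/-- The value `hol_α(γ)` in the completed enveloping algebra, for a smooth path `γ`. -/
def holAt (α : Connection I M F) (γ : SmoothPath I M) : Completion F.env :=
  completedContraction (evalSimplex γ) (hol α)

/-- The pullback `γ^*α ∈ 𝔤 ⊗̂ C^∞([0,1])` (coefficient of `dt`) of a connection along a path. -/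
def pullbackConn (γ : SmoothPath I M) (α : Connection I M F) :
    Completion (F.lin.tensor SmoothFun) :=
  completedTensorMap LinearMap.id (pullback γ) (fun _ _ h => h) α

end manifold

/-! ## Parallel transport -/

section transport

variable {𝔤 : Type u} [LieRing 𝔤] [LieAlgebra ℝ 𝔤] {F : LieFiltration 𝔤}

/-- Reversal of time, `A(t) ↦ A(1 - t)`, on `𝔤 ⊗̂ C^∞([0,1])`. -/
def reverseTime (A : Completion (F.lin.tensor SmoothFun)) : Completion (F.lin.tensor SmoothFun) :=
  completedTensorMap LinearMap.id reverseFun (fun _ _ h => h) A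

/-- The derivative with respect to time on `U(𝔤) ⊗̂ C^∞([0,1])`. -/
def timeDeriv (K : Completion (F.env.tensor SmoothFun)) : Completion (F.env.tensor SmoothFun) :=
  completedTensorMap LinearMap.id ddt (fun _ _ h => h) K

/-- The value `K_t` in the completed enveloping algebra of `K ∈ U(𝔤) ⊗̂ C^∞([0,1])`. -/
def valueAt (K : Completion (F.env.tensor SmoothFun)) (t : UI) : Completion F.env :=
  completedContraction (evalAt t) K

/-- `K ∈ U(𝔤) ⊗̂ C^∞([0,1])` solves `dK/dt = A(t) · K_t`, `K_0 = 1`. -/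
def IsTransport (A : Completion (F.lin.tensor SmoothFun))
    (K : Completion (F.env.tensor SmoothFun)) : Prop :=
  timeDeriv K = completedMul F (toEnv A) K ∧ valueAt K 0 = Completion.of F.env 1

/-- `A = ∑_i ξ^i ⊗ a_i` in `𝔤 ⊗̂ C^∞([0,1])`, where the degrees of the `ξ^i` tend to infinity. -/
def IsExpansion (A : Completion (F.lin.tensor SmoothFun)) (ξ : ℕ → 𝔤) (a : ℕ → SmoothFun) :
    Prop :=
  (∀ k, ∀ᶠ i in atTop, ξ i ∈ F.F k) ∧
    HasSum (fun i => Completion.of (F.lin.tensor SmoothFun) (ξ i ⊗ₜ[ℝ] a i)) A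

/-- The term with index `(i_1, …, i_n)`, `n ≥ 1`, of the iterated integral series:
`c^n (∫_{s ≥ t_1 ≥ ⋯ ≥ t_n ≥ 0} a_{i_1}(1 - t_1) ⋯ a_{i_n}(1 - t_n) dt_1 ⋯ dt_n) ξ^{i_1} ⋯ ξ^{i_n}`,
where `c` is a sign. -/
def seriesTerm (F : LieFiltration 𝔤) (ξ : ℕ → 𝔤) (a : ℕ → SmoothFun) (c s : ℝ)
    (p : Σ m : ℕ, Fin (m + 1) → ℕ) : Completion F.env :=
  Completion.of F.env
    ((c ^ (p.1 + 1) * iteratedIntegral (p.1 + 1) s fun j => reverseFun (a (p.2 j))) •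
      (List.ofFn fun j => envι 𝔤 (ξ (p.2 j))).prod)

end transport

end Holonomy

end

open Holonomy

noncomputable section

namespace Holonomy

universe u v w x

/-! No analytic estimate is needed: every assertion is checked modulo each `F k`, where everything
is a finite algebraic computation.

For `z` in `U(𝔤) ⊗ C^∞([0,1])` let `P w = ∫₀ᵗ z w` (`picard z`). Integration turns the equation `K'
= z K`, `K_0 = 1` into `(1 - P) K = 1`. If `z` comes from `𝔤 ⊗ C^∞([0,1])`, it has degree one
because `F 1 = ⊤`, so `P` raises the degree by one and is nilpotent modulo `F k` (`picard_pow_mem`).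
Hence the solution exists, is unique, and is the Neumann series `∑ Pⁿ 1` (`IsPicardSum.isTransport`,
`IsTransport.unique`).

For `z = ∑ uᵢ ⊗ fᵢ`, the iterate `Pⁿ 1` is a sum over words of length `n`, a product of the `uᵢ`
tensored with an iterated primitive (`picard_pow_sum`). By Fubini this primitive is the integral
over the simplex (`iteratedPrimitive_apply`). A word that is long, or contains a letter of high
degree, vanishes modulo `F k`, so the series converges unconditionally
(`IsPicardSum.hasSum_seriesTerm`).

The holonomy consists of the same words: expanding `β^{⊗n}` and applying `ψ_n` gives iterated
integrals of pullbacks along the reversed path, which is the Picard series for that path at time one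
(`IsPicardSum.valueAt_one`). The chain rule for `t ↦ 1 - t` contributes one sign per letter
(`pullback_reversal`), whence `(-1)^k`; replacing `α` by `-α` cancels it. -/

theorem SmoothFun.hasDerivAt_integral (f : SmoothFun) (t : ℝ) :
    HasDerivAt (fun s => ∫ r in (0 : ℝ)..s, extend f r) (extend f t) t :=
  intervalIntegral.integral_hasDerivAt_right (f.continuous_extend.intervalIntegrable _ _)
    (f.continuous_extend.stronglyMeasurableAtFilter _ _) f.continuous_extend.continuousAt

theorem SmoothFun.contDiffOn_integral (f : SmoothFun) :
    ContDiffOn ℝ ∞ (fun s => ∫ r in (0 : ℝ)..s, extend f r) (Set.Icc 0 1) := by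
  rw [contDiffOn_infty_iff_derivWithin (uniqueDiffOn_Icc zero_lt_one)]
  refine ⟨fun t _ => (f.hasDerivAt_integral t).differentiableAt.differentiableWithinAt,
    f.contDiffOn.congr fun t ht => ?_⟩
  exact (f.hasDerivAt_integral t).hasDerivWithinAt.derivWithin
    (uniqueDiffOn_Icc zero_lt_one t ht)

/-- The primitive of a smooth function on the unit interval that vanishes at `0`. -/
def primitive : SmoothFun →ₗ[ℝ] SmoothFun where
  toFun f := SmoothFun.mk (fun s => ∫ r in (0 : ℝ)..s, extend f r) f.contDiffOn_integral
  map_add' f g := by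
    ext t
    exact intervalIntegral.integral_add (f.continuous_extend.intervalIntegrable _ _)
      (g.continuous_extend.intervalIntegrable _ _)
  map_smul' c f := by
    ext t
    exact intervalIntegral.integral_smul c (extend f)

theorem primitive_apply (f : SmoothFun) (t : UI) :
    primitive f t = ∫ r in (0 : ℝ)..t, extend f r := rfl

theorem evalAt_primitive_zero (f : SmoothFun) : evalAt 0 (primitive f) = 0 :=
  intervalIntegral.integral_same

theorem extend_primitive (f : SmoothFun) {t : ℝ} (ht : t ∈ Set.Icc (0 : ℝ) 1) :
    extend (primitive f) t = ∫ r in (0 : ℝ)..t, extend f r :=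
  extend_coe (primitive f) ⟨t, ht⟩

theorem ddt_apply (f : SmoothFun) (t : UI) :
    ddt f t = derivWithin (extend f) (Set.Icc 0 1) t := rfl

theorem ddt_primitive (f : SmoothFun) : ddt (primitive f) = f := by
  ext t
  rw [ddt_apply, derivWithin_congr (fun s hs => extend_primitive f hs) (extend_primitive f t.2),
    (f.hasDerivAt_integral t).hasDerivWithinAt.derivWithin (uniqueDiffOn_Icc zero_lt_one t t.2),
    extend_coe]

theorem SmoothFun.eq_const_of_ddt_eq_zero {f : SmoothFun} (h : ddt f = 0) :
    f = evalAt 0 f • (1 : SmoothFun) := by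
  ext t
  have h1 := constant_of_derivWithin_zero (f := extend f) (a := 0) (b := 1)
    (f.contDiffOn.differentiableOn (by simp))
    (fun s hs => congrArg (fun g : SmoothFun => g ⟨s, hs.1, hs.2.le⟩) h) t t.2
  have h2 := extend_coe f 0
  rw [extend_coe] at h1
  rw [h1]
  change _ = f 0 * 1
  rw [← h2, mul_one]
  rfl

/-- Both sides have the same derivative, and the constant is read off at `0`. Together with
`ddt_primitive` this makes the differential equation with its initial value equivalent to an
integral equation. -/
theorem primitive_ddt (f : SmoothFun) : primitive (ddt f) = f - evalAt 0 f • (1 : SmoothFun) := by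
  have h := SmoothFun.eq_const_of_ddt_eq_zero (f := primitive (ddt f) - f)
    (by rw [map_sub, ddt_primitive, sub_self])
  rw [map_sub, evalAt_primitive_zero, zero_sub, neg_smul, sub_eq_iff_eq_add] at h
  rw [h]
  abel

theorem ddt_one : ddt 1 = 0 := by
  ext t
  rw [ddt_apply]
  exact congrFun (derivWithin_const _ (1 : ℝ)) _

/-! ## Iterated integrals as iterated primitives -/

/-- The first coordinate is the largest, so the simplex fibres over it, and the fibre over `r` is
the lower-dimensional simplex with bound `r`. -/
theorem cons_mem_simplex {n : ℕ} {s r : ℝ} {t : Fin n → ℝ} :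
    (Fin.cons r t : Fin (n + 1) → ℝ) ∈ simplex (n + 1) s ↔ r ∈ Set.Icc 0 s ∧ t ∈ simplex n r := by
  simp only [simplex, Set.mem_ofPred_eq, Fin.forall_fin_succ, Fin.cons_zero, Fin.cons_succ,
    Set.mem_Icc]
  constructor
  · rintro ⟨h1, h2, h3⟩
    refine ⟨h2, ?_, fun i => ⟨(h3 i).1, ?_⟩⟩
    · intro i j hij
      simpa using h1 (Fin.succ_le_succ_iff.2 hij)
    · simpa using h1 (Fin.zero_le i.succ)
  · rintro ⟨h1, h2, h3⟩
    refine ⟨?_, h1, fun i => ⟨(h3 i).1, (h3 i).2.trans h1.2⟩⟩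
    intro i j hij
    cases i using Fin.cases with
    | zero =>
      cases j using Fin.cases with
      | zero => exact le_rfl
      | succ j => simpa using (h3 j).2
    | succ i =>
      cases j using Fin.cases with
      | zero => exact absurd hij (by simp)
      | succ j => simpa using h2 (Fin.succ_le_succ_iff.1 hij)

theorem iteratedIntegral_zero (s : ℝ) (f : Fin 0 → SmoothFun) : iteratedIntegral 0 s f = 1 := by
  change ∫ t in simplex 0 s, ∏ i, extend (f i) (t i) = 1
  have h : simplex 0 s = Set.univ := by
    ext t
    simp [simplex, Subsingleton.antitone]
  simp [h, MeasureTheory.volume_pi, MeasureTheory.Measure.real]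

/-- Fubini, with the largest variable as the outer one. -/
theorem iteratedIntegral_succ {n : ℕ} {s : ℝ} (hs : 0 ≤ s) (f : Fin (n + 1) → SmoothFun) :
    iteratedIntegral (n + 1) s f =
      ∫ r in (0 : ℝ)..s, extend (f 0) r * iteratedIntegral n r fun i => f i.succ := by
  change ∫ t in simplex (n + 1) s, ∏ i, extend (f i) (t i) = _
  have hm := fun n s => (isCompact_simplex n s).measurableSet
  have hmp := (MeasureTheory.volume_preserving_piFinSuccAbove
    (fun _ : Fin (n + 1) => ℝ) 0).symm
  have hint : MeasureTheory.Integrable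
      ((simplex (n + 1) s).indicator fun t => ∏ i, extend (f i) (t i)) :=
    (MeasureTheory.integrable_indicator_iff (hm _ _)).2 (integrable_evalProd s f)
  rw [← MeasureTheory.integral_indicator (hm _ _), ← hmp.integral_comp']
  have hint' := (hmp.integrable_comp_emb (MeasurableEquiv.measurableEmbedding _)).2 hint
  rw [MeasureTheory.Measure.volume_eq_prod] at hint' ⊢
  refine (MeasureTheory.integral_prod _ hint').trans ?_
  rw [intervalIntegral.integral_of_le hs, ← MeasureTheory.integral_Icc_eq_integral_Ioc,
    ← MeasureTheory.integral_indicator measurableSet_Icc]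
  refine MeasureTheory.integral_congr_ae (Eventually.of_forall fun r => ?_)
  have hcons : ∀ t : Fin n → ℝ, (MeasurableEquiv.piFinSuccAbove
      (fun _ : Fin (n + 1) => ℝ) 0).symm (r, t) = Fin.cons r t := fun t => by
    simp [MeasurableEquiv.piFinSuccAbove_symm_apply, Fin.insertNthEquiv]
  classical
  simp only [Function.comp_apply, hcons]
  -- Over `r` outside `[0, s]` the fibre of the simplex is empty, and both indicators vanish.
  by_cases hr : r ∈ Set.Icc 0 s
  · rw [Set.indicator_of_mem hr]
    change _ = _ * ∫ t in simplex n r, ∏ i, extend (f i.succ) (t i)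
    rw [← MeasureTheory.integral_indicator (hm _ _), ← MeasureTheory.integral_const_mul]
    refine MeasureTheory.integral_congr_ae (Eventually.of_forall fun t => ?_)
    simp only [Set.indicator_apply, cons_mem_simplex, hr, true_and, Fin.prod_univ_succ,
      Fin.cons_zero, Fin.cons_succ, mul_ite, mul_zero]
  · rw [Set.indicator_of_notMem hr]
    simp [cons_mem_simplex, hr]

/-- The iterated integral as a smooth function of its upper limit. -/
def iteratedPrimitive : (n : ℕ) → (Fin n → SmoothFun) → SmoothFun
  | 0, _ => 1
  | n + 1, f => primitive (f 0 * iteratedPrimitive n fun i => f i.succ)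

theorem iteratedPrimitive_apply {n : ℕ} (f : Fin n → SmoothFun) (t : UI) :
    iteratedPrimitive n f t = iteratedIntegral n t f := by
  -- The upper limit must vary: the induction hypothesis is used at every `r` in `[0, t]`.
  induction n generalizing t with
  | zero => rw [iteratedIntegral_zero]; rfl
  | succ n ih =>
    rw [iteratedIntegral_succ t.2.1, iteratedPrimitive, primitive_apply]
    refine intervalIntegral.integral_congr fun r hr => ?_
    rw [Set.uIcc_of_le t.2.1] at hr
    have hr1 : r ∈ Set.Icc (0 : ℝ) 1 := ⟨hr.1, hr.2.trans t.2.2⟩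
    change extend (⇑(f 0 * iteratedPrimitive n fun i => f i.succ)) ((⟨r, hr1⟩ : UI) : ℝ) =
      extend (f 0) ((⟨r, hr1⟩ : UI) : ℝ) * _
    rw [extend_coe, extend_coe, ← ih _ ⟨r, hr1⟩]
    rfl

/-! ## Reversal of paths -/

theorem pullback_reversal {E : Type u} [NormedAddCommGroup E] [NormedSpace ℝ E]
    {H : Type v} [TopologicalSpace H] {I : ModelWithCorners ℝ E H}
    {M : Type w} [TopologicalSpace M] [ChartedSpace H M] [IsManifold I ∞ M]
    (γ : SmoothPath I M) (a : OneForm I M) :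
    pullback (γ.comp reversal) a = - reverseFun (pullback γ a) := by
  ext t
  change a (γ (reversal t)) (mfderiv (𝓡∂ 1) I (γ.comp reversal) t (1 : TangentSpace (𝓡∂ 1) t)) =
    - a (γ (reversal t)) (mfderiv (𝓡∂ 1) I γ (reversal t)
      (1 : TangentSpace (𝓡∂ 1) (reversal t)))
  have h1 := mfderivWithin_comp_projIcc_one (I := I) (f := γ.comp reversal) (w := t)
  have h2 := mfderivWithin_comp_projIcc_one (I := I) (f := γ) (w := reversal t)
  have hu := (uniqueDiffOn_Icc (zero_lt_one' ℝ) t t.2).uniqueMDiffWithinAt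
  have hg : ContMDiffOn 𝓘(ℝ) I ∞ (γ ∘ Set.projIcc (0 : ℝ) 1 zero_le_one) (Set.Icc 0 1) :=
    contMDiffOn_comp_projIcc_iff.2 γ.contMDiff
  have hr : HasDerivWithinAt (fun s : ℝ => 1 - s) (-1) (Set.Icc 0 1) t := by
    simpa using ((hasDerivAt_id (t : ℝ)).const_sub 1).hasDerivWithinAt
  -- The manifold derivative on the interval is traded for a derivative within `[0, 1] ⊆ ℝ`, where
  -- the reversal is the affine map `s ↦ 1 - s` and the chain rule applies.
  have h3 : mfderivWithin 𝓘(ℝ) I ((γ.comp reversal) ∘ Set.projIcc (0 : ℝ) 1 zero_le_one)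
      (Set.Icc 0 1) t = mfderivWithin 𝓘(ℝ) I ((γ ∘ Set.projIcc (0 : ℝ) 1 zero_le_one) ∘
        fun s : ℝ => 1 - s) (Set.Icc 0 1) t := by
    refine mfderivWithin_congr_of_mem (fun s hs => ?_) t.2
    change γ (reversal _) = γ _
    congr 1
    rw [Set.projIcc_of_mem _ hs]
    exact (Set.projIcc_of_mem _ (unitInterval.symm ⟨s, hs⟩).2).symm
  have h4 := mfderivWithin_comp (I := 𝓘(ℝ)) (I' := 𝓘(ℝ)) (I'' := I) (t : ℝ)
    (g := γ ∘ Set.projIcc (0 : ℝ) 1 zero_le_one) (f := fun s : ℝ => 1 - s)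
    (s := Set.Icc 0 1) (u := Set.Icc 0 1)
    ((hg _ (reversal t).2).mdifferentiableWithinAt (by simp))
    hr.differentiableWithinAt.mdifferentiableWithinAt
    (fun s hs => (unitInterval.symm ⟨s, hs⟩).2) hu
  have h5 : mfderivWithin 𝓘(ℝ) 𝓘(ℝ) (fun s : ℝ => 1 - s) (Set.Icc 0 1) t (1 : ℝ) = (-1 : ℝ) := by
    rw [mfderivWithin_eq_fderivWithin]
    exact hr.derivWithin (uniqueDiffOn_Icc (zero_lt_one' ℝ) t t.2)
  -- The velocities are compared in the model space `E`, since their tangent spaces are written with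
  -- different base points.
  have h6 : (mfderiv (𝓡∂ 1) I (γ.comp reversal) t (1 : TangentSpace (𝓡∂ 1) t) : E) =
      -(mfderiv (𝓡∂ 1) I γ (reversal t) (1 : TangentSpace (𝓡∂ 1) (reversal t)) : E) := by
    refine h1.symm.trans (Eq.trans ?_ (congrArg (fun v : E => -v) h2))
    rw [h3, h4]
    refine (congrArg (mfderivWithin 𝓘(ℝ) I (γ ∘ Set.projIcc (0 : ℝ) 1 zero_le_one)
      (Set.Icc 0 1) (1 - (t : ℝ))) h5).trans ?_
    exact map_neg (mfderivWithin 𝓘(ℝ) I (γ ∘ Set.projIcc (0 : ℝ) 1 zero_le_one)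
      (Set.Icc 0 1) (1 - (t : ℝ))) (1 : ℝ)
  exact (congrArg (fun v : E => (a (γ (reversal t)) : E →L[ℝ] ℝ) v) h6).trans
    (map_neg (a (γ (reversal t)) : E →L[ℝ] ℝ) _)

/-! ## Convergence in completions -/

namespace Completion

variable {V : Type u} [AddCommGroup V] [Module ℝ V] {Φ : VFiltration V}
variable {W : Type v} [AddCommGroup W] [Module ℝ W] {Ψ : VFiltration W}

theorem exists_rep (z : Completion Φ) (k : ℕ) : ∃ v, z.1 k = (Φ.F k).mkQ v := by
  obtain ⟨v, hv⟩ := Submodule.Quotient.mk_surjective _ (z.1 k)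
  exact ⟨v, hv.symm⟩

/-- The tool for computing in one quotient at a time: the later `_rep` lemmas specialise it to the
maps built from `map`. -/
theorem map_rep {f : V → W} {hf : ∀ k v v', v - v' ∈ Φ.F k → f v - f v' ∈ Ψ.F k}
    {z : Completion Φ} {k : ℕ} {v : V} (h : z.1 k = (Φ.F k).mkQ v) :
    (map f hf z).1 k = (Ψ.F k).mkQ (f v) := by
  simp only [map]
  rw [h]
  rfl

theorem sum_val {ι : Type*} (f : ι → Completion Φ) (s : Finset ι) (k : ℕ) :
    (∑ i ∈ s, f i).1 k = ∑ i ∈ s, (f i).1 k := by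
  rw [AddSubmonoidClass.coe_finsetSum, Finset.sum_apply]

/-- The topology is induced from discrete quotients, so convergence means being eventually constant
in each of them. -/
theorem tendsto_nhds_iff {β : Type*} {l : Filter β} {f : β → Completion Φ} {z : Completion Φ} :
    Tendsto f l (nhds z) ↔ ∀ k, ∀ᶠ b in l, (f b).1 k = z.1 k := by
  rw [nhds_iInf, tendsto_iInf]
  refine forall_congr' fun k => ?_
  rw [@nhds_induced _ _ ⊥, tendsto_comap_iff, @nhds_discrete _ ⊥ (discreteTopology_bot _),
    tendsto_pure]
  rfl

theorem hasSum_iff {ι : Type*} {f : ι → Completion Φ} {z : Completion Φ} :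
    HasSum f z ↔ ∀ k, ∀ᶠ s : Finset ι in atTop, ∑ i ∈ s, (f i).1 k = z.1 k := by
  rw [HasSum, tendsto_nhds_iff, SummationFilter.unconditional_filter]
  simp only [sum_val]

theorem hasSum_of_finset {ι : Type*} {f : ι → Completion Φ} {z : Completion Φ}
    (h : ∀ k, ∃ s : Finset ι, (∀ i ∉ s, (f i).1 k = 0) ∧ ∑ i ∈ s, (f i).1 k = z.1 k) :
    HasSum f z := by
  refine hasSum_iff.2 fun k => ?_
  obtain ⟨s, hs, hz⟩ := h k
  filter_upwards [eventually_ge_atTop s] with t ht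
  rw [← hz]
  exact (Finset.sum_subset ht fun i _ hi => hs i hi).symm

end Completion

/-! ### Expansions in completed tensor products -/

section tensor

variable {V : Type u} [AddCommGroup V] [Module ℝ V] {Φ : VFiltration V}
variable {W : Type v} [AddCommGroup W] [Module ℝ W]

theorem exists_eq_sum_tmul (z : V ⊗[ℝ] W) :
    ∃ (m : ℕ) (x : Fin m → V) (y : Fin m → W), z = ∑ i, x i ⊗ₜ[ℝ] y i := by
  induction z with
  | zero => exact ⟨0, Fin.elim0, Fin.elim0, by simp⟩
  | tmul x y => exact ⟨1, fun _ => x, fun _ => y, by simp⟩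
  | add a b ha hb =>
    obtain ⟨m, x, y, rfl⟩ := ha
    obtain ⟨n, x', y', rfl⟩ := hb
    exact ⟨m + n, Fin.append x x', Fin.append y y', by simp [Fin.sum_univ_add]⟩

theorem exists_eq_sum_tmul_of_mem {k : ℕ} {z : V ⊗[ℝ] W} (hz : z ∈ (Φ.tensor W).F k) :
    ∃ (m : ℕ) (x : Fin m → V) (y : Fin m → W), (∀ i, x i ∈ Φ.F k) ∧ z = ∑ i, x i ⊗ₜ[ℝ] y i := by
  obtain ⟨z, rfl⟩ := hz
  obtain ⟨m, x, y, rfl⟩ := exists_eq_sum_tmul z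
  exact ⟨m, fun i => x i, y, fun i => (x i).2, by simp⟩

theorem completedTensorMap_rep {V' : Type*} [AddCommGroup V'] [Module ℝ V'] {Φ' : VFiltration V'}
    {W' : Type*} [AddCommGroup W'] [Module ℝ W'] {f : V →ₗ[ℝ] V'} {g : W →ₗ[ℝ] W'}
    (hf : ∀ k, ∀ v ∈ Φ.F k, f v ∈ Φ'.F k) {z : Completion (Φ.tensor W)} {k : ℕ} {v : V ⊗[ℝ] W}
    (h : z.1 k = ((Φ.tensor W).F k).mkQ v) :
    (completedTensorMap f g hf z).1 k =
      ((Φ'.tensor W').F k).mkQ (TensorProduct.map f g v) := by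
  rw [completedTensorMap, Completion.map_rep h]

theorem completedContraction_rep (l : W →ₗ[ℝ] ℝ) {z : Completion (Φ.tensor W)} {k : ℕ}
    {v : V ⊗[ℝ] W} (h : z.1 k = ((Φ.tensor W).F k).mkQ v) :
    (completedContraction l z).1 k =
      (Φ.F k).mkQ (TensorProduct.rid ℝ V (LinearMap.lTensor V l v)) := by
  rw [completedContraction, Completion.map_rep h]

/-- Every element of a completed tensor product is the sum of a sequence of elementary tensors
with degrees that tend to infinity. -/
theorem exists_hasSum_tmul (h0 : Φ.F 0 = ⊤) (A : Completion (Φ.tensor W)) :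
    ∃ (x : ℕ → V) (y : ℕ → W), (∀ k, ∀ᶠ i in atTop, x i ∈ Φ.F k) ∧
      HasSum (fun i => Completion.of (Φ.tensor W) (x i ⊗ₜ[ℝ] y i)) A := by
  have htop : ∀ z, z ∈ (Φ.tensor W).F 0 := fun z => by
    induction z with
    | zero => exact Submodule.zero_mem _
    | tmul v y => exact tmul_mem (by rw [h0]; trivial) y
    | add a b ha hb => exact Submodule.add_mem _ ha hb
  -- The quotient at level `0` is trivial, so the representative there may be taken to be `0`; the
  -- telescoping sum below then has no initial term.
  have hz : ∀ k, ∃ z, (k = 0 → z = 0) ∧ A.1 k = ((Φ.tensor W).F k).mkQ z := by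
    intro k
    obtain ⟨z, hz⟩ := A.exists_rep k
    rcases Nat.eq_zero_or_pos k with rfl | hk
    · refine ⟨0, fun _ => rfl, hz.trans ?_⟩
      simpa using htop z
    · exact ⟨z, fun h => absurd h hk.ne', hz⟩
  choose z hz0 hz using hz
  -- Successive representatives differ by finitely many elementary tensors of degree `k`. All these
  -- tensors together form the expansion.
  have hd : ∀ k, z (k + 1) - z k ∈ (Φ.tensor W).F k := by
    intro k
    have h := A.2 k.le_succ
    rw [hz, hz] at h
    exact (Submodule.Quotient.eq _).1 h
  choose m x y hx hxy using fun k => exists_eq_sum_tmul_of_mem (hd k)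
  -- zero terms are added so that the index set is infinite
  let x' : (Σ k, Fin (m k) ⊕ Unit) → V := fun p => Sum.elim (x p.1) (fun _ => 0) p.2
  let y' : (Σ k, Fin (m k) ⊕ Unit) → W := fun p => Sum.elim (y p.1) (fun _ => 0) p.2
  have hx' : ∀ p, x' p ∈ Φ.F p.1 := by
    rintro ⟨k, i | i⟩
    · exact hx k i
    · exact Submodule.zero_mem _
  -- The first `k` blocks: they telescope to `z k`, and every later term has degree at least `k`.
  let S : ℕ → Finset (Σ k, Fin (m k) ⊕ Unit) := fun k =>
    (Finset.range k).sigma fun _ => Finset.univ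
  have hS : ∀ k, ∀ p ∉ S k, x' p ∈ Φ.F k := fun k p hp =>
    Φ.anti (by simpa [S] using hp) (hx' p)
  have hinf : Infinite (Σ k, Fin (m k) ⊕ Unit) :=
    Infinite.of_injective (fun k : ℕ => (⟨k, Sum.inr ()⟩ : Σ k, Fin (m k) ⊕ Unit))
      fun a b h => congrArg Sigma.fst h
  obtain ⟨e⟩ := nonempty_equiv_of_countable (α := ℕ) (β := Σ k, Fin (m k) ⊕ Unit)
  refine ⟨x' ∘ e, y' ∘ e, fun k => ?_, ?_⟩
  · rw [← Nat.cofinite_eq_atTop]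
    refine e.injective.tendsto_cofinite.eventually (p := fun p => x' p ∈ Φ.F k) ?_
    exact (S k).finite_toSet.subset fun p hp => by
      by_contra h
      exact hp (hS k p h)
  · refine e.hasSum_iff (f := fun p => Completion.of (Φ.tensor W) (x' p ⊗ₜ[ℝ] y' p)) |>.2 ?_
    refine Completion.hasSum_of_finset fun k => ⟨S k, fun p hp => ?_, ?_⟩
    · exact (Submodule.Quotient.mk_eq_zero _).2 (tmul_mem (hS k p hp) _)
    · have h1 : ∑ p ∈ S k, x' p ⊗ₜ[ℝ] y' p = z k := by
        rw [Finset.sum_sigma]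
        simp only [Fintype.sum_sum_type, x', y', Sum.elim_inl, Sum.elim_inr, ← hxy,
          Finset.sum_const, TensorProduct.zero_tmul, smul_zero, add_zero]
        rw [Finset.sum_range_sub, hz0 0 rfl, sub_zero]
      rw [hz, ← h1, map_sum]
      rfl

end tensor

/-! ## Powers of sums of elementary tensors -/

theorem sum_piFinset_succ {ι N : Type*} [DecidableEq ι] [AddCommMonoid N] {n : ℕ} (s : Finset ι)
    (f : (Fin (n + 1) → ι) → N) :
    ∑ p ∈ Fintype.piFinset (fun _ : Fin (n + 1) => s), f p =
      ∑ i ∈ s, ∑ p ∈ Fintype.piFinset (fun _ : Fin n => s), f (Fin.cons i p) := by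
  rw [← Finset.sum_product']
  symm
  refine Finset.sum_nbij' (fun q => Fin.cons q.1 q.2) (fun p => (p 0, Fin.tail p)) ?_ ?_ ?_ ?_ ?_
  · simp [Fin.forall_fin_succ]
  · simp +contextual [Fin.tail]
  · simp
  · simp
  · simp

/-- The noncommutative multinomial expansion: a sum over words, with the order of the letters kept.
-/
theorem sum_pow_eq_sum_piFinset {ι R : Type*} [DecidableEq ι] [Semiring R] (s : Finset ι)
    (x : ι → R) (n : ℕ) :
    (∑ i ∈ s, x i) ^ n =
      ∑ p ∈ Fintype.piFinset (fun _ : Fin n => s), (List.ofFn fun j => x (p j)).prod := by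
  induction n with
  | zero => simp
  | succ n ih =>
    rw [sum_piFinset_succ, pow_succ', ih, Finset.sum_mul_sum]
    simp [List.ofFn_succ]

theorem list_ofFn_tmul_prod {A B : Type*} [Ring A] [Algebra ℝ A] [Ring B] [Algebra ℝ B] {n : ℕ}
    (x : Fin n → A) (y : Fin n → B) :
    (List.ofFn fun j => x j ⊗ₜ[ℝ] y j).prod = (List.ofFn x).prod ⊗ₜ[ℝ] (List.ofFn y).prod := by
  induction n with
  | zero => simp [Algebra.TensorProduct.one_def]
  | succ n ih => simp [List.ofFn_succ, ih, Algebra.TensorProduct.tmul_mul_tmul]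

/-! ## Picard iteration -/

section picard

variable {𝔤 : Type u} [LieRing 𝔤] [LieAlgebra ℝ 𝔤]

/-- The operator `w ↦ ∫_0^t z w` on `U(𝔤) ⊗ C^∞([0,1])`. -/
def picard (z : Env 𝔤 ⊗[ℝ] SmoothFun) : Env 𝔤 ⊗[ℝ] SmoothFun →ₗ[ℝ] Env 𝔤 ⊗[ℝ] SmoothFun :=
  LinearMap.lTensor (Env 𝔤) primitive ∘ₗ LinearMap.mulLeft ℝ z

theorem picard_apply (z w : Env 𝔤 ⊗[ℝ] SmoothFun) :
    picard z w = LinearMap.lTensor (Env 𝔤) primitive (z * w) := rfl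

theorem lTensor_ddt_picard (z w : Env 𝔤 ⊗[ℝ] SmoothFun) :
    LinearMap.lTensor (Env 𝔤) ddt (picard z w) = z * w := by
  rw [picard_apply, ← LinearMap.comp_apply, ← LinearMap.lTensor_comp]
  have h : ddt ∘ₗ primitive = LinearMap.id := LinearMap.ext ddt_primitive
  rw [h, LinearMap.lTensor_id, LinearMap.id_apply]

/-- The value at `t` of an element of `U(𝔤) ⊗ C^∞([0,1])`. -/
def tensorEval (t : UI) : Env 𝔤 ⊗[ℝ] SmoothFun →ₗ[ℝ] Env 𝔤 :=
  (TensorProduct.rid ℝ (Env 𝔤)).toLinearMap ∘ₗ LinearMap.lTensor (Env 𝔤) (evalAt t)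

theorem tensorEval_tmul (t : UI) (u : Env 𝔤) (f : SmoothFun) :
    tensorEval t (u ⊗ₜ[ℝ] f) = f t • u := by
  simp [tensorEval, evalAt]

theorem tensorEval_one (t : UI) : tensorEval t (1 : Env 𝔤 ⊗[ℝ] SmoothFun) = 1 := by
  rw [Algebra.TensorProduct.one_def, tensorEval_tmul]
  exact one_smul _ _

theorem tensorEval_zero_picard (z w : Env 𝔤 ⊗[ℝ] SmoothFun) : tensorEval 0 (picard z w) = 0 := by
  rw [picard_apply, tensorEval, LinearMap.comp_apply, ← LinearMap.comp_apply,
    ← LinearMap.comp_apply, LinearMap.comp_assoc, ← LinearMap.lTensor_comp]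
  have h : evalAt 0 ∘ₗ primitive = 0 := LinearMap.ext evalAt_primitive_zero
  rw [h]
  simp

theorem lTensor_primitive_ddt (w : Env 𝔤 ⊗[ℝ] SmoothFun) :
    LinearMap.lTensor (Env 𝔤) primitive (LinearMap.lTensor (Env 𝔤) ddt w) =
      w - tensorEval 0 w ⊗ₜ[ℝ] 1 := by
  induction w with
  | zero => simp
  | tmul u f =>
    rw [tensorEval_tmul, LinearMap.lTensor_tmul, LinearMap.lTensor_tmul, primitive_ddt,
      TensorProduct.tmul_sub, TensorProduct.tmul_smul, TensorProduct.smul_tmul']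
    rfl
  | add a b ha hb =>
    simp only [map_add, ha, hb, TensorProduct.add_tmul]
    abel

theorem picard_pow_succ_apply (z w : Env 𝔤 ⊗[ℝ] SmoothFun) (n : ℕ) :
    (picard z ^ (n + 1)) w = picard z ((picard z ^ n) w) := by
  rw [pow_succ', Module.End.mul_apply]

/-- Applying the operator once more puts a new letter in front of the word and its function in the
outermost integral, which is the recursion of `iteratedPrimitive`. -/
theorem picard_pow_sum {ι : Type*} [DecidableEq ι] (s : Finset ι) (u : ι → Env 𝔤)
    (f : ι → SmoothFun) (n : ℕ) :
    (picard (∑ i ∈ s, u i ⊗ₜ[ℝ] f i) ^ n) 1 =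
      ∑ p ∈ Fintype.piFinset (fun _ : Fin n => s),
        (List.ofFn fun j => u (p j)).prod ⊗ₜ[ℝ] iteratedPrimitive n fun j => f (p j) := by
  induction n with
  | zero => simp [iteratedPrimitive, Algebra.TensorProduct.one_def]
  | succ n ih =>
    rw [sum_piFinset_succ, picard_pow_succ_apply, ih, picard_apply, Finset.sum_mul_sum]
    simp only [map_sum, Algebra.TensorProduct.tmul_mul_tmul, LinearMap.lTensor_tmul,
      List.ofFn_succ, List.prod_cons, Fin.cons_zero, Fin.cons_succ, iteratedPrimitive]

variable (F : LieFiltration 𝔤)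

theorem lTensor_mem {W : Type v} [AddCommGroup W] [Module ℝ W] {W' : Type w} [AddCommGroup W']
    [Module ℝ W'] (g : W →ₗ[ℝ] W') {k : ℕ} {z : Env 𝔤 ⊗[ℝ] W} (hz : z ∈ (F.env.tensor W).F k) :
    LinearMap.lTensor (Env 𝔤) g z ∈ (F.env.tensor W').F k :=
  tensorMap_mem LinearMap.id g (fun _ _ h => h) hz

theorem picard_mem {z w : Env 𝔤 ⊗[ℝ] SmoothFun} {i j : ℕ}
    (hz : z ∈ (F.env.tensor SmoothFun).F i) (hw : w ∈ (F.env.tensor SmoothFun).F j) :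
    picard z w ∈ (F.env.tensor SmoothFun).F (i + j) :=
  lTensor_mem F _ (envTensor_mul_mem F hz hw)

/-- Nilpotency modulo each `F k`: every step multiplies by an element of degree one, and integration
preserves degree. This takes the place of the factorial estimates of the analytic Picard theorem. -/
theorem picard_pow_mem {z : Env 𝔤 ⊗[ℝ] SmoothFun} (hz : z ∈ (F.env.tensor SmoothFun).F 1)
    (w : Env 𝔤 ⊗[ℝ] SmoothFun) (n : ℕ) : (picard z ^ n) w ∈ (F.env.tensor SmoothFun).F n := by
  induction n with
  | zero => exact envTensor_mem_zero F _
  | succ n ih =>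
    rw [picard_pow_succ_apply, Nat.add_comm]
    exact picard_mem F hz ih

theorem picard_pow_sub_mem {k : ℕ} {z z' : Env 𝔤 ⊗[ℝ] SmoothFun}
    (h : z - z' ∈ (F.env.tensor SmoothFun).F k) (n : ℕ) :
    (picard z ^ n) 1 - (picard z' ^ n) 1 ∈ (F.env.tensor SmoothFun).F k := by
  induction n with
  | zero => simp
  | succ n ih =>
    rw [picard_pow_succ_apply, picard_pow_succ_apply, picard_apply, picard_apply, ← map_sub]
    exact lTensor_mem F _ (envTensor_mul_sub_mem F h ih)

/-- The partial sum, up to the power `k`, of the Picard series. -/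
def picardSum (k : ℕ) (z : Env 𝔤 ⊗[ℝ] SmoothFun) : Env 𝔤 ⊗[ℝ] SmoothFun :=
  ∑ n ∈ Finset.range (k + 1), (picard z ^ n) 1

theorem picardSum_sub_mem {k : ℕ} {z z' : Env 𝔤 ⊗[ℝ] SmoothFun}
    (h : z - z' ∈ (F.env.tensor SmoothFun).F k) (m : ℕ) :
    picardSum m z - picardSum m z' ∈ (F.env.tensor SmoothFun).F k := by
  rw [picardSum, picardSum, ← Finset.sum_sub_distrib]
  exact Submodule.sum_mem _ fun n _ => picard_pow_sub_mem F h n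

theorem picardSum_sub_picardSum_mem {j k : ℕ} (hjk : j ≤ k) {z : Env 𝔤 ⊗[ℝ] SmoothFun}
    (hz : z ∈ (F.env.tensor SmoothFun).F 1) :
    picardSum k z - picardSum j z ∈ (F.env.tensor SmoothFun).F j := by
  rw [picardSum, picardSum, ← Finset.sum_Ico_eq_sub _ (Nat.succ_le_succ hjk)]
  refine Submodule.sum_mem _ fun n hn => ?_
  exact (F.env.tensor SmoothFun).anti (Nat.le_of_succ_le (Finset.mem_Ico.1 hn).1)
    (picard_pow_mem F hz 1 n)

end picard

/-! ### Existence, uniqueness and series for parallel transport -/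

section transport

variable {𝔤 : Type u} [LieRing 𝔤] [LieAlgebra ℝ 𝔤] {F : LieFiltration 𝔤}

variable (F) in
theorem prod_ofFn_mem {n k : ℕ} (x : Fin n → 𝔤) (l : Fin n → ℕ) (h : ∀ j, x j ∈ F.F (l j))
    (hk : k ≤ ∑ j, l j) : (List.ofFn fun j => envι 𝔤 (x j)).prod ∈ F.env.F k := by
  refine Submodule.subset_span ⟨List.ofFn fun j => (l j, x j), ?_, ?_, ?_⟩
  · simpa [List.forall_mem_ofFn_iff] using h
  · simpa [List.map_ofFn, Function.comp_def, List.sum_ofFn] using hk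
  · simp [listProd, List.map_ofFn, Function.comp_def]

variable (F) in
theorem mem_F_one (y : 𝔤) : y ∈ F.F 1 := by
  rw [F.one_eq]
  trivial

variable (F) in
theorem rTensor_envι_mem {W : Type v} [AddCommGroup W] [Module ℝ W] (z : 𝔤 ⊗[ℝ] W) :
    LinearMap.rTensor W (envι 𝔤) z ∈ (F.env.tensor W).F 1 := by
  induction z with
  | zero => rw [map_zero]; exact Submodule.zero_mem _
  | tmul v y => exact tmul_mem (envι_mem F 1 v (mem_F_one F v)) y
  | add a b ha hb => rw [map_add]; exact Submodule.add_mem _ ha hb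

theorem rTensor_envι_mem_of_mem {W : Type v} [AddCommGroup W] [Module ℝ W] {k : ℕ} {z : 𝔤 ⊗[ℝ] W}
    (hz : z ∈ (F.lin.tensor W).F k) : LinearMap.rTensor W (envι 𝔤) z ∈ (F.env.tensor W).F k :=
  tensorMap_mem (envι 𝔤) LinearMap.id (envι_mem F) hz

/-- `K` is the sum of the Picard iterates of `1` for the equation `dK/dt = B(t) K_t`. -/
def IsPicardSum (B : Completion (F.lin.tensor SmoothFun))
    (K : Completion (F.env.tensor SmoothFun)) : Prop :=
  ∀ k z, B.1 k = ((F.lin.tensor SmoothFun).F k).mkQ z →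
    K.1 k = ((F.env.tensor SmoothFun).F k).mkQ
      (picardSum k (LinearMap.rTensor SmoothFun (envι 𝔤) z))

theorem exists_isPicardSum (B : Completion (F.lin.tensor SmoothFun)) : ∃ K, IsPicardSum B K := by
  choose z hz using B.exists_rep
  let w := fun k => LinearMap.rTensor SmoothFun (envι 𝔤) (z k)
  have hw : ∀ k z', B.1 k = ((F.lin.tensor SmoothFun).F k).mkQ z' →
      w k - LinearMap.rTensor SmoothFun (envι 𝔤) z' ∈ (F.env.tensor SmoothFun).F k := by
    intro k z' hz'
    rw [← map_sub]
    exact rTensor_envι_mem_of_mem ((Submodule.Quotient.eq _).1 ((hz k).symm.trans hz'))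
  refine ⟨⟨fun k => ((F.env.tensor SmoothFun).F k).mkQ (picardSum k (w k)), ?_⟩, ?_⟩
  · intro j k hjk
    refine (Submodule.Quotient.eq _).2 ?_
    have h1 : B.1 j = ((F.lin.tensor SmoothFun).F j).mkQ (z k) := by
      rw [← B.2 hjk, hz]
      rfl
    -- Two changes are separated: shortening the sum from `k` to `j`, and replacing the
    -- representative `z k` by `z j`.
    rw [← sub_add_sub_cancel _ (picardSum j (w k))]
    refine Submodule.add_mem _ (picardSum_sub_picardSum_mem F hjk (rTensor_envι_mem F _)) ?_
    rw [← neg_sub]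
    exact Submodule.neg_mem _ (picardSum_sub_mem F (hw j (z k) h1) j)
  · intro k z' hz'
    exact (Submodule.Quotient.eq _).2 (picardSum_sub_mem F (hw k z' hz') k)

/-- Each iterate differentiates to `z` times the previous one. Only the last iterate has no
successor in the sum, and this error is invisible modulo `F k` when `z` has degree one. -/
theorem lTensor_ddt_picardSum (k : ℕ) (z : Env 𝔤 ⊗[ℝ] SmoothFun) :
    LinearMap.lTensor (Env 𝔤) ddt (picardSum k z) =
      z * picardSum k z - z * (picard z ^ k) 1 := by
  have h0 : LinearMap.lTensor (Env 𝔤) ddt (1 : Env 𝔤 ⊗[ℝ] SmoothFun) = 0 := by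
    rw [Algebra.TensorProduct.one_def, LinearMap.lTensor_tmul, ddt_one, TensorProduct.tmul_zero]
  rw [← mul_sub, picardSum]
  nth_rw 1 [Finset.sum_range_succ']
  rw [Finset.sum_range_succ, add_sub_cancel_right, map_add, pow_zero, Module.End.one_apply, h0,
    add_zero, map_sum, Finset.mul_sum]
  simp only [picard_pow_succ_apply, lTensor_ddt_picard]

theorem tensorEval_zero_picardSum (k : ℕ) (z : Env 𝔤 ⊗[ℝ] SmoothFun) :
    tensorEval 0 (picardSum k z) = 1 := by
  rw [picardSum, Finset.sum_range_succ', map_add, pow_zero, Module.End.one_apply, tensorEval_one,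
    map_sum]
  simp [picard_pow_succ_apply, tensorEval_zero_picard]

theorem toEnv_rep {W : Type v} [AddCommGroup W] [Module ℝ W] {B : Completion (F.lin.tensor W)}
    {k : ℕ} {z : 𝔤 ⊗[ℝ] W} (hz : B.1 k = ((F.lin.tensor W).F k).mkQ z) :
    (toEnv B).1 k = ((F.env.tensor W).F k).mkQ (LinearMap.rTensor W (envι 𝔤) z) :=
  completedTensorMap_rep (envι_mem F) hz

theorem valueAt_rep {K : Completion (F.env.tensor SmoothFun)} {k : ℕ} {v : Env 𝔤 ⊗[ℝ] SmoothFun}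
    (hv : K.1 k = ((F.env.tensor SmoothFun).F k).mkQ v) (t : UI) :
    (valueAt K t).1 k = (F.env.F k).mkQ (tensorEval t v) :=
  completedContraction_rep (evalAt t) hv

theorem timeDeriv_rep {K : Completion (F.env.tensor SmoothFun)} {k : ℕ}
    {v : Env 𝔤 ⊗[ℝ] SmoothFun} (hv : K.1 k = ((F.env.tensor SmoothFun).F k).mkQ v) :
    (timeDeriv K).1 k =
      ((F.env.tensor SmoothFun).F k).mkQ (LinearMap.lTensor (Env 𝔤) ddt v) :=
  completedTensorMap_rep (fun _ _ h => h) hv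

theorem completedMul_rep {Z K : Completion (F.env.tensor SmoothFun)} {k : ℕ}
    {z v : Env 𝔤 ⊗[ℝ] SmoothFun} (hz : Z.1 k = ((F.env.tensor SmoothFun).F k).mkQ z)
    (hv : K.1 k = ((F.env.tensor SmoothFun).F k).mkQ v) :
    (completedMul F Z K).1 k = ((F.env.tensor SmoothFun).F k).mkQ (z * v) := by
  simp only [completedMul, Completion.map₂]
  rw [hz, hv]
  rfl

theorem IsPicardSum.isTransport {B : Completion (F.lin.tensor SmoothFun)}
    {K : Completion (F.env.tensor SmoothFun)} (hK : IsPicardSum B K) : IsTransport B K := by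
  constructor
  · refine Subtype.ext (funext fun k => ?_)
    obtain ⟨z, hz⟩ := B.exists_rep k
    rw [timeDeriv_rep (hK k z hz), completedMul_rep (toEnv_rep hz) (hK k z hz),
      lTensor_ddt_picardSum]
    refine (Submodule.Quotient.eq _).2 ?_
    rw [sub_sub_cancel_left]
    refine Submodule.neg_mem _ ?_
    have h := envTensor_mul_mem F (envTensor_mem_zero F (LinearMap.rTensor SmoothFun (envι 𝔤) z))
      (picard_pow_mem F (rTensor_envι_mem F z) 1 k)
    rwa [Nat.zero_add] at h
  · refine Subtype.ext (funext fun k => ?_)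
    obtain ⟨z, hz⟩ := B.exists_rep k
    rw [valueAt_rep (hK k z hz), tensorEval_zero_picardSum]
    rfl

/-- The difference `d` of two solutions satisfies `d ≡ P d` modulo `F k`, hence `d ≡ Pᵏ d ≡ 0`. -/
theorem IsTransport.unique {B : Completion (F.lin.tensor SmoothFun)}
    {K K' : Completion (F.env.tensor SmoothFun)} (hK : IsTransport B K) (hK' : IsTransport B K') :
    K = K' := by
  refine Subtype.ext (funext fun k => ?_)
  obtain ⟨z, hz⟩ := B.exists_rep k
  set w := LinearMap.rTensor SmoothFun (envι 𝔤) z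
  -- Integrating the equation and adding the initial condition, tensored with the constant function
  -- `1`, gives the integral equation modulo `F k`.
  have key : ∀ L : Completion (F.env.tensor SmoothFun), IsTransport B L → ∀ v,
      L.1 k = ((F.env.tensor SmoothFun).F k).mkQ v →
      v - picard w v - 1 ∈ (F.env.tensor SmoothFun).F k := by
    intro L hL v hv
    have h1 := congrArg (fun y => y.1 k) hL.1
    have h2 := congrArg (fun y => y.1 k) hL.2
    simp only [timeDeriv_rep hv, completedMul_rep (toEnv_rep hz) hv] at h1
    simp only [valueAt_rep hv] at h2
    have h3 := lTensor_mem F primitive ((Submodule.Quotient.eq _).1 h1)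
    have h4 := tmul_mem (W := SmoothFun) ((Submodule.Quotient.eq _).1 h2) 1
    rw [map_sub, lTensor_primitive_ddt] at h3
    rw [TensorProduct.sub_tmul, ← Algebra.TensorProduct.one_def] at h4
    have h5 := Submodule.add_mem _ h3 h4
    rw [picard_apply]
    convert h5 using 1
    abel
  obtain ⟨v, hv⟩ := K.exists_rep k
  obtain ⟨v', hv'⟩ := K'.exists_rep k
  rw [hv, hv']
  refine (Submodule.Quotient.eq _).2 ?_
  have h1 : (v - v') - picard w (v - v') ∈ (F.env.tensor SmoothFun).F k := by
    have h := Submodule.sub_mem _ (key K hK v hv) (key K' hK' v' hv')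
    rw [map_sub]
    convert h using 1
    abel
  have h2 : ∀ n, (v - v') - (picard w ^ n) (v - v') ∈ (F.env.tensor SmoothFun).F k := by
    intro n
    induction n with
    | zero => simp
    | succ n ih =>
      have h := picard_mem F (envTensor_mem_zero F w) ih
      rw [Nat.zero_add, map_sub] at h
      have h' := Submodule.add_mem _ h1 h
      rwa [sub_add_sub_cancel, ← picard_pow_succ_apply] at h'
  have h3 := Submodule.add_mem _ (h2 k) (picard_pow_mem F (rTensor_envι_mem F z) (v - v') k)
  rwa [sub_add_cancel] at h3

theorem tensorEval_picardSum {ι : Type*} [DecidableEq ι] (s : Finset ι) (u : ι → Env 𝔤)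
    (f : ι → SmoothFun) (k : ℕ) (t : UI) :
    tensorEval t (picardSum k (∑ i ∈ s, u i ⊗ₜ[ℝ] f i)) = 1 +
      ∑ n ∈ Finset.range k, ∑ p ∈ Fintype.piFinset (fun _ : Fin (n + 1) => s),
        iteratedIntegral (n + 1) t (fun j => f (p j)) • (List.ofFn fun j => u (p j)).prod := by
  rw [picardSum, Finset.sum_range_succ', map_add, pow_zero, Module.End.one_apply, tensorEval_one,
    add_comm, map_sum]
  simp only [picard_pow_sum, map_sum, tensorEval_tmul, iteratedPrimitive_apply]

/-- For an expansion of `A`, the solution of `dK/dt = c A(1 - t) K_t`, `K_0 = 1` is the series of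
iterated integrals. -/
theorem IsPicardSum.hasSum_seriesTerm {A B : Completion (F.lin.tensor SmoothFun)}
    {K : Completion (F.env.tensor SmoothFun)} (hK : IsPicardSum B K) {c : ℝ}
    (hB : B = c • reverseTime A) {ξ : ℕ → 𝔤} {a : ℕ → SmoothFun} (hA : IsExpansion A ξ a) (t : UI) :
    HasSum (seriesTerm F ξ a c t) (valueAt K t - Completion.of F.env 1) := by
  refine Completion.hasSum_of_finset fun k => ?_
  have hξ := hA.1 k
  rw [← Nat.cofinite_eq_atTop, eventually_cofinite] at hξ
  -- A finite set large enough for two purposes: its partial sum represents `A` modulo `F k`, and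
  -- every `ξ i` outside it lies in `F k`.
  obtain ⟨s, hs1, hs2⟩ := ((Completion.hasSum_iff.1 hA.2 k).and
    (eventually_ge_atTop hξ.toFinset)).exists
  have hs : ∀ i ∉ s, ξ i ∈ F.F k := fun i hi => by
    by_contra h
    exact hi (hs2 (hξ.mem_toFinset.2 h))
  have hz : B.1 k = ((F.lin.tensor SmoothFun).F k).mkQ
      (∑ i ∈ s, ξ i ⊗ₜ[ℝ] (c • reverseFun (a i))) := by
    have h1 : A.1 k = ((F.lin.tensor SmoothFun).F k).mkQ (∑ i ∈ s, ξ i ⊗ₜ[ℝ] a i) := by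
      rw [← hs1, map_sum]
      rfl
    have h2 : (reverseTime A).1 k = ((F.lin.tensor SmoothFun).F k).mkQ
        (LinearMap.lTensor 𝔤 reverseFun (∑ i ∈ s, ξ i ⊗ₜ[ℝ] a i)) :=
      completedTensorMap_rep (fun _ _ h => h) h1
    rw [hB]
    change c • (reverseTime A).1 k = _
    rw [h2, ← map_smul, map_sum, Finset.smul_sum]
    simp only [LinearMap.lTensor_tmul, TensorProduct.tmul_smul]
  -- The surviving words have length at most `k` and letters in `s`; the index `n` stands for length
  -- `n + 1`.
  refine ⟨(Finset.range k).sigma fun n => Fintype.piFinset fun _ : Fin (n + 1) => s, ?_, ?_⟩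
  · rintro ⟨n, p⟩ hp
    refine (Submodule.Quotient.mk_eq_zero _).2 (Submodule.smul_mem _ _ ?_)
    simp only [Finset.mem_sigma, Finset.mem_range, Fintype.mem_piFinset, not_and, not_forall] at hp
    by_cases hn : n < k
    · obtain ⟨j, hj⟩ := hp hn
      -- The letter outside `s` alone supplies degree `k`; the other letters have degree one.
      refine prod_ofFn_mem F _ (fun i => if i = j then k else 1) (fun i => ?_) ?_
      · split_ifs with h
        · rw [h]; exact hs _ hj
        · exact mem_F_one F _
      · simpa using Finset.single_le_sum (f := fun i => if i = j then k else 1)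
          (fun i _ => Nat.zero_le _) (Finset.mem_univ j)
    · refine prod_ofFn_mem F _ (fun _ => 1) (fun i => mem_F_one F _) ?_
      simp only [Finset.sum_const, Finset.card_univ, Fintype.card_fin, smul_eq_mul]
      omega
  · change _ = (valueAt K t).1 k - (F.env.F k).mkQ 1
    rw [valueAt_rep (hK k _ hz), map_sum]
    simp only [LinearMap.rTensor_tmul]
    rw [tensorEval_picardSum, ← map_sub, add_sub_cancel_left, Finset.sum_sigma, map_sum]
    refine Finset.sum_congr rfl fun n _ => ?_
    rw [map_sum]
    refine Finset.sum_congr rfl fun p _ => ?_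
    -- Multilinearity extracts one factor `c` per letter, giving `c ^ (n + 1)`.
    rw [MultilinearMap.map_smul_univ]
    simp [seriesTerm, Completion.of]

end transport

/-! ### Holonomy as parallel transport along the reversed path -/

section manifold

variable {E : Type u} [NormedAddCommGroup E] [NormedSpace ℝ E]
variable {H : Type v} [TopologicalSpace H] {I : ModelWithCorners ℝ E H}
variable {M : Type w} [TopologicalSpace M] [ChartedSpace H M] [IsManifold I ∞ M]
variable {𝔤 : Type x} [LieRing 𝔤] [LieAlgebra ℝ 𝔤] {F : LieFiltration 𝔤}

theorem pullbackConn_rep (γ : SmoothPath I M) {α : Connection I M F} {k : ℕ}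
    {z : 𝔤 ⊗[ℝ] OneForm I M} (hz : α.1 k = ((F.lin.tensor (OneForm I M)).F k).mkQ z) :
    (pullbackConn γ α).1 k =
      ((F.lin.tensor SmoothFun).F k).mkQ (LinearMap.lTensor 𝔤 (pullback γ) z) :=
  completedTensorMap_rep (fun _ _ h => h) hz

theorem pushTerm_rep (n : ℕ) {β : Completion (F.env.tensor (OneForm I M))} {k : ℕ}
    {z : Env 𝔤 ⊗[ℝ] OneForm I M} (hz : β.1 k = ((F.env.tensor (OneForm I M)).F k).mkQ z) :
    (pushTerm n β).1 k = ((F.env.tensor (Cochain1 I M)).F k).mkQ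
      (LinearMap.lTensor (Env 𝔤) (psiBar I M)
        ((LinearMap.lTensor (Env 𝔤) (TensorAlgebra.ι ℝ) z) ^ n)) := by
  rw [pushTerm, Completion.map_rep hz]

theorem pullbackConn_neg (γ : SmoothPath I M) (α : Connection I M F) :
    pullbackConn γ (-α) = - pullbackConn γ α := by
  refine Subtype.ext (funext fun k => ?_)
  obtain ⟨z, hz⟩ := α.exists_rep k
  have hz' : (-α).1 k = ((F.lin.tensor (OneForm I M)).F k).mkQ (-z) := by
    rw [map_neg, ← hz]
    rfl
  change _ = - (pullbackConn γ α).1 k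
  rw [pullbackConn_rep γ hz, pullbackConn_rep γ hz', map_neg, map_neg]

theorem pullbackConn_reversal (γ : SmoothPath I M) (α : Connection I M F) :
    pullbackConn (γ.comp reversal) α = - reverseTime (pullbackConn γ α) := by
  refine Subtype.ext (funext fun k => ?_)
  obtain ⟨z, hz⟩ := α.exists_rep k
  have h : (reverseTime (pullbackConn γ α)).1 k = ((F.lin.tensor SmoothFun).F k).mkQ
      (LinearMap.lTensor 𝔤 reverseFun (LinearMap.lTensor 𝔤 (pullback γ) z)) :=
    completedTensorMap_rep (fun _ _ h => h) (pullbackConn_rep γ hz)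
  have h' : pullback (γ.comp reversal) = -(reverseFun ∘ₗ pullback γ) :=
    LinearMap.ext fun a => pullback_reversal γ a
  change _ = - (reverseTime (pullbackConn γ α)).1 k
  rw [h, pullbackConn_rep _ hz, h', LinearMap.lTensor_neg, LinearMap.lTensor_comp, ← map_neg]
  rfl

theorem psiBar_prod_ofFn {n : ℕ} (hn : n ≠ 0) (a : Fin n → OneForm I M) (γ : SmoothPath I M) :
    psiBar I M (List.ofFn fun j => TensorAlgebra.ι ℝ (a j)).prod γ =
      iteratedIntegral n 1 fun j => pullback (γ.comp reversal) (a j) := by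
  rw [← TensorAlgebra.tprod_apply, psiBar, barLift_tprod _ hn]
  rfl

/-- Modulo `F k`, a finite representative of `α` turns both sides into the same sum over words. No
expansion of the pullback is involved. -/
theorem IsPicardSum.valueAt_one {α : Connection I M F} {γ : SmoothPath I M}
    {K : Completion (F.env.tensor SmoothFun)}
    (hK : IsPicardSum (pullbackConn (γ.comp reversal) α) K) :
    valueAt K 1 = Completion.of F.env 1 + holAt α γ := by
  refine Subtype.ext (funext fun k => ?_)
  obtain ⟨z, hz⟩ := α.exists_rep k
  obtain ⟨m, y, a, rfl⟩ := exists_eq_sum_tmul z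
  have h1 : (hol α).1 k = ((F.env.tensor (Cochain1 I M)).F k).mkQ
      (∑ n ∈ Finset.Icc 1 k, LinearMap.lTensor (Env 𝔤) (psiBar I M)
        ((LinearMap.lTensor (Env 𝔤) (TensorAlgebra.ι ℝ)
          (LinearMap.rTensor (OneForm I M) (envι 𝔤) (∑ i, y i ⊗ₜ[ℝ] a i))) ^ n)) := by
    rw [map_sum]
    simp only [hol]
    exact Finset.sum_congr rfl fun n _ => pushTerm_rep n (toEnv_rep hz)
  change _ = (F.env.F k).mkQ 1 + (holAt α γ).1 k
  rw [holAt, completedContraction_rep _ h1, ← map_add, valueAt_rep (hK k _ (pullbackConn_rep _ hz))]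
  congr 1
  simp only [map_sum, LinearMap.lTensor_tmul, LinearMap.rTensor_tmul]
  rw [tensorEval_picardSum]
  congr 1
  -- Reindexing by word length `1, …, k`. The length `k`, negligible modulo `F k`, is kept in
  -- `picardSum` and in `hol` alike, so the sums agree term by term.
  rw [Finset.range_eq_Ico, Finset.sum_Ico_add' (fun n => ∑ p ∈ Fintype.piFinset
    (fun _ : Fin n => Finset.univ), iteratedIntegral n ((1 : UI) : ℝ)
      (fun j => pullback (γ.comp reversal) (a (p j))) •
        (List.ofFn fun j => envι 𝔤 (y (p j))).prod) 0 k 1]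
  refine Finset.sum_congr (by ext; simp) fun n hn => ?_
  have hn0 : n ≠ 0 := by
    have := (Finset.mem_Icc.1 hn).1
    omega
  rw [sum_pow_eq_sum_piFinset]
  simp only [map_sum, list_ofFn_tmul_prod, LinearMap.lTensor_tmul, TensorProduct.rid_tmul]
  refine Finset.sum_congr rfl fun p _ => ?_
  congr 1
  exact (psiBar_prod_ofFn hn0 _ γ).symm

end manifold

end Holonomy

end

open Holonomy

theorem mainTheorem3
    {E : Type*} [NormedAddCommGroup E] [NormedSpace ℝ E]
    {H : Type*} [TopologicalSpace H] (I : ModelWithCorners ℝ E H)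
    {M : Type*} [TopologicalSpace M] [ChartedSpace H M] [IsManifold I ∞ M]
    {𝔤 : Type*} [LieRing 𝔤] [LieAlgebra ℝ 𝔤] (F : LieFiltration 𝔤)
    (α : Connection I M F) (γ : SmoothPath I M) :
    -- the pullback of the connection can be written as a sum `∑ ξ^i ⊗ a_i(t) dt`
    (∃ (ξ : ℕ → 𝔤) (a : ℕ → SmoothFun), IsExpansion (pullbackConn γ α) ξ a) ∧
    -- the holonomy is the iterated integral series
    (∀ (ξ : ℕ → 𝔤) (a : ℕ → SmoothFun), IsExpansion (pullbackConn γ α) ξ a →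
      HasSum (seriesTerm F ξ a (-1) 1) (holAt α γ)) ∧
    -- the pullback along the reversed path is `- (γ^*α)(1 - t)`
    pullbackConn (γ.comp reversal) α = - reverseTime (pullbackConn γ α) ∧
    -- the parallel transport along the reversed path
    (∃ K : Completion (F.env.tensor SmoothFun),
      IsTransport (pullbackConn (γ.comp reversal) α) K ∧
      (∀ K', IsTransport (pullbackConn (γ.comp reversal) α) K' → K' = K) ∧
      (∀ (ξ : ℕ → 𝔤) (a : ℕ → SmoothFun), IsExpansion (pullbackConn γ α) ξ a →
        ∀ t : UI, HasSum (seriesTerm F ξ a (-1) t) (valueAt K t - Completion.of F.env 1)) ∧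
      valueAt K 1 = Completion.of F.env 1 + holAt α γ) ∧
    -- the same for the connection with the opposite sign: all the signs disappear
    (∃ K : Completion (F.env.tensor SmoothFun),
      IsTransport (reverseTime (pullbackConn γ α)) K ∧
      (∀ K', IsTransport (reverseTime (pullbackConn γ α)) K' → K' = K) ∧
      (∀ (ξ : ℕ → 𝔤) (a : ℕ → SmoothFun), IsExpansion (pullbackConn γ α) ξ a →
        HasSum (seriesTerm F ξ a 1 1) (holAt (-α) γ) ∧
        ∀ t : UI, HasSum (seriesTerm F ξ a 1 t) (valueAt K t - Completion.of F.env 1)) ∧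
      valueAt K 1 = Completion.of F.env 1 + holAt (-α) γ) := by
  have hrev := pullbackConn_reversal γ α
  have hneg : pullbackConn (γ.comp reversal) (-α) = reverseTime (pullbackConn γ α) := by
    rw [pullbackConn_neg, hrev, neg_neg]
  obtain ⟨K, hK⟩ := exists_isPicardSum (pullbackConn (γ.comp reversal) α)
  obtain ⟨L, hL⟩ := exists_isPicardSum (pullbackConn (γ.comp reversal) (-α))
  have hK1 := hK.valueAt_one
  have hL1 := hL.valueAt_one
  have hKs := fun ξ a h => hK.hasSum_seriesTerm (c := -1) (by rw [hrev]; exact (neg_one_smul ℝ _).symm)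
    (A := pullbackConn γ α) (ξ := ξ) (a := a) h
  have hLs := fun ξ a h => hL.hasSum_seriesTerm (c := 1) (by rw [hneg, one_smul])
    (A := pullbackConn γ α) (ξ := ξ) (a := a) h
  have hF : F.lin.F 0 = ⊤ := by simp [LieFiltration.lin, F.zero_eq]
  refine ⟨exists_hasSum_tmul hF _, fun ξ a h => ?_, hrev,
    ⟨K, hK.isTransport, fun K' h => h.unique hK.isTransport, hKs, hK1⟩,
    ⟨L, hneg ▸ hL.isTransport, fun K' h => h.unique (hneg ▸ hL.isTransport),
      fun ξ a h => ⟨?_, hLs ξ a h⟩, hL1⟩⟩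
  -- The series for the holonomy is the transport series at time one.
  · have h' := hKs ξ a h 1
    rwa [hK1, add_sub_cancel_left] at h'
  · have h' := hLs ξ a h 1
    rwa [hL1, add_sub_cancel_left] at h'
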